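/- Write $[m]=\{1,\dots,m\}$. For positive integers $n\ge r$ and $k\ge 2$, a $k$-signed $r$-set on $[n]$ is a set $\{(x_1,y_1),\dots,(x_r,y_r)\}$ with $x_1,\dots,x_r\in[n]$ pairwise distinct and $y_1,\dots,y_r\in[k]$; let $\mathcal L_{n,r,k}$ be the family of all of them. A family $\mathcal F\subseteq\mathcal L_{n,r,k}$ is $t$-intersecting if $|A\cap B|\ge t$ for all $A,B\in\mathcal F$; it is trivial if all its members contain a fixed $k$-signed $t$-set on $[n]$, and non-trivial otherwise. Two families $\mathcal F,\mathcal G\subseteq\mathcal L_{n,r,k}$ are isomorphic, $\mathcal F\cong\mathcal G$, if there is a bijection $\sigma$ of $[n]\times[k]$ onto itself with $\mathcal G=\{\sigma(F):F\in\mathcal F\}$. Let $M_d=\{(1,1),(2,1),\dots,(d,1)\}$ for $d\in[n]$. For $k\ge2$, $t+1\le r\le n$ and $t+2\le\ell\le\min\{r+1,n\}$, let $\mathcal H_1(n,r,k,\ell,t)$ be the family of all $F\in\mathcal L_{n,r,k}$ such that either $M_t\subseteq F$ and $|F\cap M_\ell|\ge t+1$, or $M_t\not\subseteq F$ and $|F\cap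 M_\ell|=\ell-1$. Finally, put $$g(n,r,t)=\frac{(r-t+3)(r-t-1)}{n-t-1}\cdot\max\left\{\binom{t+2}{2},\frac{r-t+1}{2}\right\}.$$ Theorem. Let $n,r,k,t$ be positive integers with $n\ge t+2\ge4$, $n\ge r\ge t+1$ and $k\ge\max\{2,g(n,r,t)\}$, and let $\mathcal F\subseteq\mathcal L_{n,r,k}$ be a non-trivial $t$-intersecting family of maximum size among all non-trivial $t$-intersecting subfamilies of $\mathcal L_{n,r,k}$. (i) If $\min\{r+1,n\}\le2t+2$, then $\mathcal F\cong\mathcal H_1(n,r,k,t+2,t)$. (ii) If $\min\{r+1,n\}>2t+2$, then $\mathcal F\cong\mathcal H_1(n,r,k,\min\{r+1,n\},t)$. -/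

import Mathlib

/-- The family of `k`-signed `r`-sets on `[n]`: the sets of `r` pairs whose first coordinates are
pairwise distinct. Here `[n]` and `[k]` are modelled by `Fin n` and `Fin k`, so that the
element `i` of `[n]` (or of `[k]`) is written `i - 1`. -/
def signedSets (n r k : ℕ) : Finset (Finset (Fin n × Fin k)) :=
  Finset.univ.filter fun F => F.card = r ∧ ∀ a ∈ F, ∀ b ∈ F, a.1 = b.1 → a = b

/-- Any two members of the family have at least `t` elements in common. -/
def IsTIntersecting {n k : ℕ} (t : ℕ) (𝓕 : Finset (Finset (Fin n × Fin k))) : Prop :=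
  ∀ A ∈ 𝓕, ∀ B ∈ 𝓕, t ≤ (A ∩ B).card

/-- All members of the family contain a fixed `k`-signed `t`-set. -/
def IsTrivialFamily {n k : ℕ} (t : ℕ) (𝓕 : Finset (Finset (Fin n × Fin k))) : Prop :=
  ∃ S ∈ signedSets n t k, ∀ A ∈ 𝓕, S ⊆ A

/-- Non-trivial `t`-intersecting families of `k`-signed `r`-sets on `[n]`. -/
def IsNontrivialTIntersecting (n r k t : ℕ) (𝓕 : Finset (Finset (Fin n × Fin k))) : Prop :=
  𝓕 ⊆ signedSets n r k ∧ IsTIntersecting t 𝓕 ∧ ¬ IsTrivialFamily t 𝓕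

/-- Non-trivial `t`-intersecting families of maximum size. -/
def IsLargestNontrivialTIntersecting (n r k t : ℕ)
    (𝓕 : Finset (Finset (Fin n × Fin k))) : Prop :=
  IsNontrivialTIntersecting n r k t 𝓕 ∧
    ∀ 𝓖 : Finset (Finset (Fin n × Fin k)),
      IsNontrivialTIntersecting n r k t 𝓖 → 𝓖.card ≤ 𝓕.card

/-- Two families are isomorphic if a bijection of `[n] × [k]` maps one onto the other. -/
def FamilyIso {n k : ℕ} (𝓕 𝓖 : Finset (Finset (Fin n × Fin k))) : Prop :=
  ∃ σ : Equiv.Perm (Fin n × Fin k), 𝓖 = 𝓕.image fun A => A.image σ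

/-- `M_d = {(1,1), (2,1), …, (d,1)}` (shifted to start at `0`). -/
def initialM (n k d : ℕ) : Finset (Fin n × Fin k) :=
  Finset.univ.filter fun x => x.1.val < d ∧ x.2.val = 0

/-- The family `H₁(n,r,k,ℓ,t)`. -/
def familyH1 (n r k l t : ℕ) : Finset (Finset (Fin n × Fin k)) :=
  (signedSets n r k).filter fun F =>
    (initialM n k t ⊆ F ∧ t + 1 ≤ (F ∩ initialM n k l).card) ∨
    (¬ initialM n k t ⊆ F ∧ (F ∩ initialM n k l).card + 1 = l)

/-- The function `g(n,r,t)`; all subtractions and divisions are those of real numbers. -/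
noncomputable def gBound (n r t : ℕ) : ℝ :=
  (((r : ℝ) - t + 3) * ((r : ℝ) - t - 1)) / ((n : ℝ) - t - 1) *
    max (((t + 2).choose 2 : ℕ) : ℝ) (((r : ℝ) - t + 1) / 2)

/-!
Let `𝓕` be a largest non-trivial `t`-intersecting family, let `N(s) = extCount n r k s` be the
number of signed `r`-sets containing a given signed `s`-set, and put `d = r - t + 1`. Counting
pairs gives `(r - s) N(s) = (n - s) k N(s + 1)`, so the hypothesis on `k` says that
`N(s) ≥ (d + 2) max(C(t + 2, 2), d / 2) N(s + 1)` for `s > t` (`mul_extCount_succ_le`): prescribing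
one more element is expensive. The size of `𝓕` is therefore governed by its `t`-covers of size
`t + 1`, where a `t`-cover is a signed set sharing at least `t` elements with every member.

If `S` is not a `t`-cover, then some `d` elements meet all members containing `S`
(`exists_branching_set`), so at most `d N(|S| + 1)` members contain `S`. Branching from the
`t`-subsets of a smallest cover shows that `𝓕` has at most `C(t + 2, 2) d² N(t + 2)` members if no
cover has size `t + 1` (`card_le_of_no_small_cover`), which is less than the size of an extremal
family.

By maximality, every signed `r`-set containing a cover belongs to `𝓕`, and because `k ≥ 2` two
covers can be extended without creating new common elements. Hence covers `t`-intersect each other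
(`IsLargestNontrivialTIntersecting.le_card_inter_of_isCover`). The covers of size `t + 1` therefore
either include three subsets of one `(t + 2)`-set, and then `𝓕` is the family `H₁` with `ℓ = t + 2`
(`exists_subset_pairFamily_of_three`), or they are the sets `X ∪ {z}` for a fixed `t`-set `X` and
`z` ranging over a set `Z` of petals. In the second case a member not containing `X` contains `Z`
and all of `X` but one element, so that `|X ∪ Z| ≤ min(r + 1, n)`. With equality, `𝓕` is the family `H₁`
with `ℓ = min(r + 1, n)` (`subset_pairFamily_of_card_petals`). Otherwise `𝓕` has about
`|Z| N(t + 1)` members, up to small multiples of `N(t + 2)`. Comparison with the sizes of the two families `H₁`,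
about `(t + 2) N(t + 1)` and `(min(r + 1, n) - t) N(t + 1)`, selects the right one. The two main
terms agree when `min(r + 1, n) = 2t + 2`; there the terms in `N(t + 2)` decide
(`card_filter_meets_add_le`).
-/

/-! ### Signed sets -/

/-- A set of pairs is signed if no two of its elements have the same first coordinate. -/
def IsSigned {n k : ℕ} (S : Finset (Fin n × Fin k)) : Prop :=
  ∀ a ∈ S, ∀ b ∈ S, a.1 = b.1 → a = b

/-- The signed `r`-sets that contain `S`. -/
def signedSupersets {n k : ℕ} (r : ℕ) (S : Finset (Fin n × Fin k)) :
    Finset (Finset (Fin n × Fin k)) :=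
  (signedSets n r k).filter (S ⊆ ·)

/-- The number of `k`-signed `r`-sets on `[n]` that contain a given signed `s`-set. The case
distinction is needed because of the truncated subtraction in `r - s`. -/
def extCount (n r k s : ℕ) : ℕ :=
  if s ≤ r then (n - s).choose (r - s) * k ^ (r - s) else 0

section Signed

variable {n r k : ℕ} {S T G : Finset (Fin n × Fin k)}

lemma mem_signedSets : S ∈ signedSets n r k ↔ S.card = r ∧ IsSigned S := by
  simp [signedSets, IsSigned]

lemma mem_signedSupersets :
    T ∈ signedSupersets r S ↔ T ∈ signedSets n r k ∧ S ⊆ T := by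
  simp [signedSupersets]

lemma IsSigned.mono (hT : IsSigned T) (h : S ⊆ T) : IsSigned S :=
  fun a ha b hb => hT a (h ha) b (h hb)

lemma isSigned_singleton (w : Fin n × Fin k) : IsSigned {w} := by
  intro a ha b hb _
  rw [Finset.mem_singleton] at ha hb
  rw [ha, hb]

lemma IsSigned.injOn_fst (hS : IsSigned S) : Set.InjOn Prod.fst (S : Set (Fin n × Fin k)) :=
  fun a ha b hb h => hS a ha b hb h

lemma IsSigned.card_image_fst (hS : IsSigned S) : (S.image Prod.fst).card = S.card :=
  Finset.card_image_of_injOn hS.injOn_fst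

lemma IsSigned.card_le (hS : IsSigned S) : S.card ≤ n := by
  rw [← hS.card_image_fst]
  exact (Finset.card_le_univ _).trans (by simp)

lemma IsSigned.insert_of_notMem_image (hS : IsSigned S) {w : Fin n × Fin k}
    (hw : w.1 ∉ S.image Prod.fst) : IsSigned (insert w S) := by
  intro a ha b hb hab
  have key : ∀ c ∈ S, c.1 ≠ w.1 := fun c hc h =>
    hw (h ▸ Finset.mem_image_of_mem Prod.fst hc)
  rcases Finset.mem_insert.1 ha with ha | ha <;> rcases Finset.mem_insert.1 hb with hb | hb
  · rw [ha, hb]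
  · exact absurd (hab.symm.trans (congrArg Prod.fst ha)) (key b hb)
  · exact absurd (hab.trans (congrArg Prod.fst hb)) (key a ha)
  · exact hS a ha b hb hab

/-- Every signed set of at most `r` elements extends to a signed `r`-set, and for `k ≥ 2` the new
elements can be chosen outside any given signed set: on each free coordinate, that set occupies
at most one of the `k` symbols. -/
lemma IsSigned.exists_extension (hk : 2 ≤ k) (hrn : r ≤ n) (hS : IsSigned S) (hSr : S.card ≤ r)
    (hG : IsSigned G) : ∃ F ∈ signedSets n r k, S ⊆ F ∧ F ∩ G ⊆ S := by
  classical
  have hf : ∀ i : Fin n, ∃ y : Fin k, (i, y) ∉ G := by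
    intro i
    by_contra! h
    have := hG _ (h ⟨0, by omega⟩) _ (h ⟨1, by omega⟩) rfl
    simp at this
  choose f hf using hf
  obtain ⟨B, hBA, hB⟩ : ∃ B ⊆ (S.image Prod.fst)ᶜ, B.card = r - S.card := by
    apply Finset.exists_subset_card_eq
    rw [Finset.card_compl, hS.card_image_fst, Fintype.card_fin]
    omega
  have hBS : ∀ i ∈ B, ∀ a ∈ S, a.1 ≠ i := by
    intro i hi a ha h
    exact Finset.mem_compl.1 (hBA hi) (h ▸ Finset.mem_image_of_mem Prod.fst ha)
  refine ⟨S ∪ B.image fun i => (i, f i), mem_signedSets.2 ⟨?_, ?_⟩,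
    Finset.subset_union_left, ?_⟩
  · rw [Finset.card_union_of_disjoint, Finset.card_image_of_injective, hB]
    · omega
    · exact fun i j h => congrArg Prod.fst h
    · rw [Finset.disjoint_left]
      intro a ha ha'
      obtain ⟨i, hi, rfl⟩ := Finset.mem_image.1 ha'
      exact hBS i hi _ ha rfl
  · intro a ha b hb hab
    rcases Finset.mem_union.1 ha with ha | ha <;> rcases Finset.mem_union.1 hb with hb | hb
    · exact hS a ha b hb hab
    · obtain ⟨i, hi, rfl⟩ := Finset.mem_image.1 hb
      exact absurd hab (hBS i hi a ha)
    · obtain ⟨i, hi, rfl⟩ := Finset.mem_image.1 ha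
      exact absurd hab.symm (hBS i hi b hb)
    · obtain ⟨i, hi, rfl⟩ := Finset.mem_image.1 ha
      obtain ⟨j, hj, rfl⟩ := Finset.mem_image.1 hb
      simp only at hab
      rw [hab]
  · intro a ha
    obtain ⟨h1, h2⟩ := Finset.mem_inter.1 ha
    rcases Finset.mem_union.1 h1 with h | h
    · exact h
    · obtain ⟨i, hi, rfl⟩ := Finset.mem_image.1 h
      exact absurd h2 (hf i)

end Signed

/-! ### Counting signed supersets -/

section Counting

variable {n r k : ℕ} {S T : Finset (Fin n × Fin k)}

lemma extCount_self (n r k : ℕ) : extCount n r k r = 1 := by simp [extCount]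

lemma extCount_of_lt {n r k s : ℕ} (h : r < s) : extCount n r k s = 0 := by
  simp [extCount, Nat.not_le.2 h]

lemma extCount_mul (n r k : ℕ) {s : ℕ} (hs : s < r) (hrn : r ≤ n) :
    extCount n r k s * (r - s) = (n - s) * k * extCount n r k (s + 1) := by
  obtain ⟨b, rfl⟩ : ∃ b, r = s + 1 + b := ⟨r - s - 1, by omega⟩
  obtain ⟨a, rfl⟩ : ∃ a, n = s + 1 + a := ⟨n - s - 1, by omega⟩
  have e1 : s + 1 + a - s = a + 1 := by omega
  have e2 : s + 1 + b - s = b + 1 := by omega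
  have e3 : s + 1 + a - (s + 1) = a := by omega
  have e4 : s + 1 + b - (s + 1) = b := by omega
  have := Nat.add_one_mul_choose_eq a b
  rw [extCount, extCount, if_pos (by omega), if_pos (by omega), e1, e2, e3, e4, pow_succ]
  calc (a + 1).choose (b + 1) * (k ^ b * k) * (b + 1)
      = ((a + 1).choose (b + 1) * (b + 1)) * (k ^ b * k) := by ring
    _ = _ := by rw [← this]; ring

lemma extCount_pos (hk : 0 < k) {s : ℕ} (hs : s ≤ r) (hrn : r ≤ n) : 0 < extCount n r k s := by
  rw [extCount, if_pos hs]
  exact Nat.mul_pos (Nat.choose_pos (by omega)) (by positivity)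

/-- Double counting of the pairs `(F, w)` with `S ⊆ F` and `w ∈ F \ S`. -/
lemma IsSigned.card_signedSupersets_mul (hS : IsSigned S) {N : ℕ}
    (hN : ∀ w : Fin n × Fin k, w.1 ∉ S.image Prod.fst →
      (signedSupersets r (insert w S)).card = N) :
    (signedSupersets r S).card * (r - S.card) = (n - S.card) * k * N := by
  classical
  have hC : (((S.image Prod.fst)ᶜ ×ˢ (Finset.univ : Finset (Fin k)))).card =
      (n - S.card) * k := by
    rw [Finset.card_product, Finset.card_compl, hS.card_image_fst]
    simp
  rw [← hC]
  refine Finset.card_mul_eq_card_mul (fun F w => w ∈ F) ?_ ?_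
  · intro F hF
    obtain ⟨hF, hSF⟩ := mem_signedSupersets.1 hF
    obtain ⟨hFr, hFs⟩ := mem_signedSets.1 hF
    have : Finset.bipartiteAbove (fun (F : Finset (Fin n × Fin k)) w => w ∈ F)
        ((S.image Prod.fst)ᶜ ×ˢ (Finset.univ : Finset (Fin k))) F = F \ S := by
      ext w
      simp only [Finset.mem_bipartiteAbove, Finset.mem_product, Finset.mem_compl,
        Finset.mem_univ, and_true, Finset.mem_sdiff]
      constructor
      · rintro ⟨h1, h2⟩
        exact ⟨h2, fun h => h1 (Finset.mem_image_of_mem _ h)⟩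
      · rintro ⟨h1, h2⟩
        refine ⟨fun h => ?_, h1⟩
        obtain ⟨a, ha, haw⟩ := Finset.mem_image.1 h
        exact h2 (hFs a (hSF ha) w h1 haw ▸ ha)
    rw [this, Finset.card_sdiff_of_subset hSF, hFr]
  · intro w hw
    rw [← hN w (by simpa using hw)]
    congr 1
    ext F
    simp only [Finset.mem_bipartiteBelow, mem_signedSupersets, Finset.insert_subset_iff]
    tauto

lemma IsSigned.card_signedSupersets (hrn : r ≤ n) (hS : IsSigned S) :
    (signedSupersets r S).card = extCount n r k S.card := by
  classical
  rcases Nat.lt_or_ge r S.card with h | h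
  · rw [extCount_of_lt h, Finset.card_eq_zero, Finset.eq_empty_iff_forall_notMem]
    intro F hF
    obtain ⟨hF, hSF⟩ := mem_signedSupersets.1 hF
    have := Finset.card_le_card hSF
    have := (mem_signedSets.1 hF).1
    omega
  obtain ⟨j, hj⟩ : ∃ j, S.card + j = r := ⟨r - S.card, by omega⟩
  induction j generalizing S with
  | zero =>
    have : signedSupersets r S = {S} := by
      ext F
      rw [mem_signedSupersets, mem_signedSets, Finset.mem_singleton]
      constructor
      · rintro ⟨⟨h1, -⟩, h2⟩
        exact (Finset.eq_of_subset_of_card_le h2 (by omega)).symm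
      · rintro rfl
        exact ⟨⟨hj, hS⟩, subset_rfl⟩
    rw [this, ← hj, Nat.add_zero, extCount_self, Finset.card_singleton]
  | succ j ih =>
    have key := hS.card_signedSupersets_mul (r := r) (N := extCount n r k (S.card + 1)) (by
      intro w hw
      have hw' : w ∉ S := fun h => hw (Finset.mem_image_of_mem _ h)
      have hc := Finset.card_insert_of_notMem hw'
      rw [← hc]
      exact ih (hS.insert_of_notMem_image hw) (by omega) (by omega))
    rw [← extCount_mul n r k (by omega) hrn] at key
    exact Nat.eq_of_mul_eq_mul_right (by omega) key

lemma card_signedSupersets_le (hrn : r ≤ n) (S : Finset (Fin n × Fin k)) :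
    (signedSupersets r S).card ≤ extCount n r k S.card := by
  by_cases hS : IsSigned S
  · exact (hS.card_signedSupersets hrn).le
  · rw [Finset.card_eq_zero.2]
    · exact Nat.zero_le _
    · rw [Finset.eq_empty_iff_forall_notMem]
      intro F hF
      obtain ⟨hF, hSF⟩ := mem_signedSupersets.1 hF
      exact hS ((mem_signedSets.1 hF).2.mono hSF)

/-- If `k` is at least `c * (r - t - 1) / (n - t - 1)`, then each further prescribed element
costs a factor of at least `c`. The step `s = t + 1` is the critical one, since
`(n - s) / (r - s)` increases with `s`. -/
lemma mul_extCount_succ_le {t c q : ℕ} (hrn : r ≤ n)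
    (hc : c * (r - t - 1) ≤ q * (k * (n - t - 1))) {s : ℕ} (hs : t + 1 ≤ s) :
    c * extCount n r k (s + 1) ≤ q * extCount n r k s := by
  rcases Nat.lt_or_ge s r with h | h
  · have key := extCount_mul n r k h hrn
    obtain ⟨a, rfl⟩ : ∃ a, s = t + 1 + a := ⟨s - t - 1, by omega⟩
    obtain ⟨b, rfl⟩ : ∃ b, r = t + 1 + a + (b + 1) := ⟨r - (t + 1 + a) - 1, by omega⟩
    obtain ⟨c', rfl⟩ : ∃ c', n = t + 1 + a + (b + 1) + c' :=
      ⟨n - (t + 1 + a + (b + 1)), by omega⟩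
    have e1 : t + 1 + a + (b + 1) - t - 1 = a + (b + 1) := by omega
    have e2 : t + 1 + a + (b + 1) + c' - t - 1 = a + (b + 1) + c' := by omega
    have e3 : t + 1 + a + (b + 1) - (t + 1 + a) = b + 1 := by omega
    have e4 : t + 1 + a + (b + 1) + c' - (t + 1 + a) = (b + 1) + c' := by omega
    rw [e1, e2] at hc
    rw [e3, e4] at key
    set A := extCount (t + 1 + a + (b + 1) + c') (t + 1 + a + (b + 1)) k (t + 1 + a)
    set B := extCount (t + 1 + a + (b + 1) + c') (t + 1 + a + (b + 1)) k (t + 1 + a + 1)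
    have h1 : c * (b + 1) ≤ q * (k * (b + 1 + c')) := by
      have h2 : (a + (b + 1) + c') * (b + 1) ≤ (b + 1 + c') * (a + (b + 1)) := by nlinarith
      have h3 : (c * (b + 1)) * (a + (b + 1)) ≤ (q * (k * (b + 1 + c'))) * (a + (b + 1)) :=
        calc (c * (b + 1)) * (a + (b + 1)) = (c * (a + (b + 1))) * (b + 1) := by ring
          _ ≤ (q * (k * (a + (b + 1) + c'))) * (b + 1) := Nat.mul_le_mul_right _ hc
          _ = q * k * ((a + (b + 1) + c') * (b + 1)) := by ring
          _ ≤ q * k * ((b + 1 + c') * (a + (b + 1))) := Nat.mul_le_mul_left _ h2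
          _ = _ := by ring
      exact Nat.le_of_mul_le_mul_right h3 (by omega)
    refine Nat.le_of_mul_le_mul_right (c := b + 1) ?_ (by omega)
    calc c * B * (b + 1) = (c * (b + 1)) * B := by ring
      _ ≤ (q * (k * (b + 1 + c'))) * B := Nat.mul_le_mul_right _ h1
      _ = q * (((b + 1) + c') * k * B) := by ring
      _ = q * A * (b + 1) := by rw [← key]; ring
  · rw [extCount_of_lt (by omega)]
    simp

end Counting

/-! ### The extremal families -/

/-- The family `H₁` built on an arbitrary pair of signed sets `X ⊆ Y` instead of on the pair
`M_t ⊆ M_ℓ`; the parameters `t` and `ℓ` are the cardinalities of `X` and `Y`. -/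
def pairFamily {n k : ℕ} (r : ℕ) (X Y : Finset (Fin n × Fin k)) :
    Finset (Finset (Fin n × Fin k)) :=
  (signedSets n r k).filter fun F =>
    (X ⊆ F ∧ X.card + 1 ≤ (F ∩ Y).card) ∨ (¬ X ⊆ F ∧ (F ∩ Y).card + 1 = Y.card)

section PairFamily

variable {n r k : ℕ} {X Y F : Finset (Fin n × Fin k)}

lemma mem_pairFamily : F ∈ pairFamily r X Y ↔ F ∈ signedSets n r k ∧
    ((X ⊆ F ∧ X.card + 1 ≤ (F ∩ Y).card) ∨ (¬ X ⊆ F ∧ (F ∩ Y).card + 1 = Y.card)) := by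
  simp [pairFamily]

lemma isSigned_initialM (n k d : ℕ) : IsSigned (initialM n k d) := by
  intro a ha b hb hab
  simp only [initialM, Finset.mem_filter, Finset.mem_univ, true_and] at ha hb
  exact Prod.ext hab (Fin.ext (ha.2.trans hb.2.symm))

lemma image_fst_initialM (hk : 0 < k) (d : ℕ) :
    (initialM n k d).image Prod.fst = Finset.univ.filter fun i : Fin n => i.val < d := by
  ext i
  simp only [initialM, Finset.mem_image, Finset.mem_filter, Finset.mem_univ, true_and]
  constructor
  · rintro ⟨a, ha, rfl⟩
    exact ha.1
  · intro hi
    exact ⟨(i, ⟨0, hk⟩), ⟨hi, rfl⟩, rfl⟩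

lemma card_initialM (hk : 0 < k) {d : ℕ} (hd : d ≤ n) : (initialM n k d).card = d := by
  rw [← (isSigned_initialM n k d).card_image_fst, image_fst_initialM hk, Fin.card_filter_val_lt]
  exact min_eq_right hd

lemma initialM_mono {d l : ℕ} (h : d ≤ l) : initialM n k d ⊆ initialM n k l := by
  intro a ha
  simp only [initialM, Finset.mem_filter, Finset.mem_univ, true_and] at ha ⊢
  exact ⟨ha.1.trans_le h, ha.2⟩

lemma familyH1_eq_pairFamily (hk : 0 < k) {l t : ℕ} (ht : t ≤ n) (hl : l ≤ n) :
    familyH1 n r k l t = pairFamily r (initialM n k t) (initialM n k l) := by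
  rw [familyH1, pairFamily, card_initialM hk ht, card_initialM hk hl]

/-- A permutation that carries one nested pair of sets to another one of the same sizes. -/
lemma exists_perm_of_nested {A B A' B' : Finset (Fin n)} (hAB : A ⊆ B) (hAB' : A' ⊆ B')
    (hA : A.card = A'.card) (hB : B.card = B'.card) :
    ∃ π : Equiv.Perm (Fin n), ∀ i, (i ∈ A → π i ∈ A') ∧ (i ∈ B → π i ∈ B') := by
  classical
  let colour : Finset (Fin n) → Finset (Fin n) → Fin n → ℕ :=
    fun A B i => if i ∈ A then 0 else if i ∈ B then 1 else 2
  have h0 : ∀ A B i, colour A B i = 0 ↔ i ∈ A := by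
    intro A B i
    simp only [colour]
    split_ifs <;> simp_all
  have h1 : ∀ A B i, colour A B i = 1 ↔ i ∈ B \ A := by
    intro A B i
    simp only [colour]
    split_ifs <;> simp_all
  have h2 : ∀ A B i, A ⊆ B → (colour A B i = 2 ↔ i ∈ Bᶜ) := by
    intro A B i h
    have := @h i
    simp only [colour]
    split_ifs <;> simp_all
  have h3 : ∀ A B i c, colour A B i ≠ c + 3 := by
    intro A B i c
    simp only [colour]
    split_ifs <;> omega
  have e : ∀ c, Nonempty ({ i // colour A B i = c } ≃ { i // colour A' B' i = c }) := by
    intro c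
    apply Fintype.card_eq.1
    match c with
    | 0 => simp only [h0, Fintype.card_coe, hA]
    | 1 =>
      simp only [h1, Fintype.card_coe, Finset.card_sdiff_of_subset hAB,
        Finset.card_sdiff_of_subset hAB', hA, hB]
    | 2 =>
      simp only [h2 _ _ _ hAB, h2 _ _ _ hAB', Fintype.card_coe, Finset.card_compl, hB]
    | c + 3 => simp only [h3]
  let π : Equiv.Perm (Fin n) := Equiv.ofFiberEquiv fun c => (e c).some
  have hπ : ∀ i, colour A' B' (π i) = colour A B i := fun i => Equiv.ofFiberEquiv_map _ i
  have hπA : ∀ i, i ∈ A → π i ∈ A' := fun i hi => by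
    rw [← h0 A' B', hπ, h0]
    exact hi
  refine ⟨π, fun i => ⟨hπA i, fun hi => ?_⟩⟩
  by_cases hiA : i ∈ A
  · exact hAB' (hπA i hiA)
  · have : π i ∈ B' \ A' := by
      rw [← h1, hπ, h1]
      exact Finset.mem_sdiff.2 ⟨hi, hiA⟩
    exact (Finset.mem_sdiff.1 this).1

/-- Permuting the coordinates, and then the symbols on each coordinate separately, carries any
nested pair of signed sets to the pair `M_t ⊆ M_ℓ`. -/
lemma exists_perm_image_initialM (hk : 0 < k) (hY : IsSigned Y) (hXY : X ⊆ Y) :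
    ∃ σ : Equiv.Perm (Fin n × Fin k), (∀ a b, (σ a).1 = (σ b).1 ↔ a.1 = b.1) ∧
      X.image σ = initialM n k X.card ∧ Y.image σ = initialM n k Y.card := by
  classical
  have hX := hY.mono hXY
  have hXn := hX.card_le
  have hYn := hY.card_le
  have hle := Finset.card_le_card hXY
  obtain ⟨π, hπ⟩ := exists_perm_of_nested (Finset.image_subset_image (f := Prod.fst) hXY)
    (Finset.image_subset_image (f := Prod.fst) (initialM_mono (n := n) (k := k) hle))
    (by rw [hX.card_image_fst, (isSigned_initialM n k _).card_image_fst, card_initialM hk hXn])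
    (by rw [hY.card_image_fst, (isSigned_initialM n k _).card_image_fst, card_initialM hk hYn])
  have hy : ∀ i : Fin n, ∃ y : Fin k, ∀ a, (i, a) ∈ Y → a = y := by
    intro i
    by_cases h : ∃ a, (i, a) ∈ Y
    · obtain ⟨a, ha⟩ := h
      exact ⟨a, fun b hb => congrArg Prod.snd (hY _ hb _ ha rfl)⟩
    · exact ⟨⟨0, hk⟩, fun a ha => absurd ⟨a, ha⟩ h⟩
  choose y hy using hy
  let σ : Equiv.Perm (Fin n × Fin k) := Equiv.prodShear π fun i => Equiv.swap (y i) ⟨0, hk⟩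
  have hσ : ∀ a, σ a = (π a.1, Equiv.swap (y a.1) ⟨0, hk⟩ a.2) := fun a => rfl
  have hσY : ∀ a ∈ Y, σ a = (π a.1, ⟨0, hk⟩) := by
    intro a ha
    rw [hσ, hy a.1 a.2 ha, Equiv.swap_apply_left]
  refine ⟨σ, fun a b => by rw [hσ, hσ]; exact π.injective.eq_iff, ?_, ?_⟩
  · apply Finset.eq_of_subset_of_card_le
    · intro b hb
      obtain ⟨a, ha, rfl⟩ := Finset.mem_image.1 hb
      have := (hπ a.1).1 (Finset.mem_image_of_mem _ ha)
      rw [image_fst_initialM hk, Finset.mem_filter] at this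
      rw [hσY a (hXY ha)]
      simpa [initialM] using this.2
    · rw [card_initialM hk hXn, Finset.card_image_of_injective _ σ.injective]
  · apply Finset.eq_of_subset_of_card_le
    · intro b hb
      obtain ⟨a, ha, rfl⟩ := Finset.mem_image.1 hb
      have := (hπ a.1).2 (Finset.mem_image_of_mem _ ha)
      rw [image_fst_initialM hk, Finset.mem_filter] at this
      rw [hσY a ha]
      simpa [initialM] using this.2
    · rw [card_initialM hk hYn, Finset.card_image_of_injective _ σ.injective]

lemma image_mem_pairFamily_iff {σ : Equiv.Perm (Fin n × Fin k)}
    (hσ : ∀ a b, (σ a).1 = (σ b).1 ↔ a.1 = b.1) :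
    F.image σ ∈ pairFamily r (X.image σ) (Y.image σ) ↔ F ∈ pairFamily r X Y := by
  have hs : IsSigned (F.image σ) ↔ IsSigned F := by
    simp only [IsSigned, Finset.forall_mem_image, hσ, σ.injective.eq_iff]
  rw [mem_pairFamily, mem_pairFamily, mem_signedSets, mem_signedSets, hs,
    Finset.image_subset_image_iff σ.injective, ← Finset.image_inter _ _ σ.injective,
    Finset.card_image_of_injective _ σ.injective, Finset.card_image_of_injective _ σ.injective,
    Finset.card_image_of_injective _ σ.injective, Finset.card_image_of_injective _ σ.injective]

lemma familyIso_pairFamily (hk : 0 < k) (hY : IsSigned Y) (hXY : X ⊆ Y) :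
    FamilyIso (pairFamily r X Y) (familyH1 n r k Y.card X.card) := by
  classical
  obtain ⟨σ, hσ, hσX, hσY⟩ := exists_perm_image_initialM hk hY hXY
  refine ⟨σ, ?_⟩
  rw [familyH1_eq_pairFamily hk (hY.mono hXY).card_le hY.card_le, ← hσX, ← hσY]
  ext G
  have hG : (G.image σ.symm).image σ = G := by
    rw [Finset.image_image]
    simp
  rw [Finset.mem_image]
  constructor
  · intro h
    rw [← hG, image_mem_pairFamily_iff hσ] at h
    exact ⟨_, h, hG⟩
  · rintro ⟨F, hF, rfl⟩
    exact (image_mem_pairFamily_iff hσ).2 hF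

lemma pairFamily_isTIntersecting (hXY : X.card + 2 ≤ Y.card) :
    IsTIntersecting X.card (pairFamily r X Y) := by
  classical
  intro A hA B hB
  have key : (A ∩ Y).card + (B ∩ Y).card ≤ Y.card + (A ∩ B).card := by
    rw [← Finset.card_union_add_card_inter]
    refine Nat.add_le_add (Finset.card_le_card ?_) (Finset.card_le_card ?_)
    · exact Finset.union_subset Finset.inter_subset_right Finset.inter_subset_right
    · exact Finset.inter_subset_inter Finset.inter_subset_left Finset.inter_subset_left
  rcases (mem_pairFamily.1 hA).2 with ⟨h1, h2⟩ | ⟨h1, h2⟩ <;>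
    rcases (mem_pairFamily.1 hB).2 with ⟨h3, h4⟩ | ⟨h3, h4⟩
  · exact Finset.card_le_card (Finset.subset_inter h1 h3)
  all_goals omega

/-- No nonempty signed set of size `|X|` lies in all members of the family: a set different from
`X` has an element outside `X`, and some member containing `X` avoids that element; the set `X`
itself is missed by a member that contains `Y` up to one element of `X`. -/
lemma pairFamily_not_isTrivialFamily (hk : 2 ≤ k) (hrn : r ≤ n) (hY : IsSigned Y) (hsub : X ⊆ Y)
    (hX : 0 < X.card) (hXY : X.card + 2 ≤ Y.card) (hYr : Y.card ≤ r + 1) :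
    ¬ IsTrivialFamily X.card (pairFamily r X Y) := by
  classical
  rintro ⟨S, hS, hSF⟩
  obtain ⟨hSc, hSs⟩ := mem_signedSets.1 hS
  by_cases hSX : S ⊆ X
  · have hSX : S = X := Finset.eq_of_subset_of_card_le hSX hSc.ge
    obtain ⟨x, hx⟩ := Finset.card_pos.1 hX
    have hxY := hsub hx
    have hce := Finset.card_erase_of_mem hxY
    obtain ⟨F, hF, hYF, hFx⟩ := (hY.mono (Finset.erase_subset x Y)).exists_extension hk hrn
      (by omega) (isSigned_singleton x)
    have hxF : x ∉ F := fun h =>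
      Finset.notMem_erase x Y (hFx (Finset.mem_inter.2 ⟨h, Finset.mem_singleton_self x⟩))
    have hFY : F ∩ Y = Y.erase x := by
      ext a
      rw [Finset.mem_inter, Finset.mem_erase]
      constructor
      · rintro ⟨h1, h2⟩
        exact ⟨fun h => hxF (h ▸ h1), h2⟩
      · rintro ⟨h1, h2⟩
        exact ⟨hYF (Finset.mem_erase.2 ⟨h1, h2⟩), h2⟩
    have hmem : F ∈ pairFamily r X Y := by
      refine mem_pairFamily.2 ⟨hF, Or.inr ⟨fun h => hxF (h hx), ?_⟩⟩
      rw [hFY]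
      omega
    exact hxF (hSF F hmem (hSX ▸ hx))
  · obtain ⟨s, hsS, hsX⟩ := Finset.not_subset.1 hSX
    obtain ⟨z, hz⟩ : ((Y \ X).erase s).Nonempty := by
      rw [← Finset.card_pos]
      have h1 := Finset.card_sdiff_of_subset hsub
      have h2 := Finset.pred_card_le_card_erase (s := Y \ X) (a := s)
      omega
    rw [Finset.mem_erase, Finset.mem_sdiff] at hz
    obtain ⟨hzs, hzY, hzX⟩ := hz
    have hsub' : insert z X ⊆ Y := Finset.insert_subset hzY hsub
    have hci := Finset.card_insert_of_notMem hzX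
    obtain ⟨F, hF, hXF, hFs⟩ := (hY.mono hsub').exists_extension hk hrn
      (by omega) (isSigned_singleton s)
    have hmem : F ∈ pairFamily r X Y := by
      refine mem_pairFamily.2 ⟨hF, Or.inl ⟨(Finset.subset_insert z X).trans hXF, ?_⟩⟩
      rw [← hci]
      exact Finset.card_le_card (Finset.subset_inter hXF hsub')
    have := hFs (Finset.mem_inter.2 ⟨hSF F hmem hsS, Finset.mem_singleton_self s⟩)
    rcases Finset.mem_insert.1 this with h | h
    · exact hzs h.symm
    · exact hsX h

lemma pairFamily_isNontrivialTIntersecting (hk : 2 ≤ k) (hrn : r ≤ n) (hY : IsSigned Y)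
    (hsub : X ⊆ Y) (hX : 0 < X.card) (hXY : X.card + 2 ≤ Y.card) (hYr : Y.card ≤ r + 1) :
    IsNontrivialTIntersecting n r k X.card (pairFamily r X Y) :=
  ⟨Finset.filter_subset _ _, pairFamily_isTIntersecting hXY,
    pairFamily_not_isTrivialFamily hk hrn hY hsub hX hXY hYr⟩

/-! ### Sizes of the extremal families -/

lemma sum_card_filter_mem {α : Type*} [DecidableEq α] (𝓢 : Finset (Finset α)) (Z : Finset α) :
    ∑ z ∈ Z, (𝓢.filter (z ∈ ·)).card = ∑ F ∈ 𝓢, (F ∩ Z).card := by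
  have h : ∀ F : Finset α, (F ∩ Z).card = ∑ z ∈ Z, if z ∈ F then 1 else 0 := by
    intro F
    rw [← Finset.card_filter, Finset.inter_comm, Finset.filter_mem_eq_inter]
  simp only [h, Finset.card_filter]
  exact Finset.sum_comm

lemma filter_mem_signedSupersets (z : Fin n × Fin k) :
    (signedSupersets r X).filter (z ∈ ·) = signedSupersets r (insert z X) := by
  ext F
  simp only [Finset.mem_filter, mem_signedSupersets, Finset.insert_subset_iff]
  tauto

/-- For `|Y| = |X| + 2`, the family consists of the sets that contain all of `Y` but at most one
element. -/
lemma extCount_le_card_pairFamily_add (hrn : r ≤ n) (hY : IsSigned Y) (hsub : X ⊆ Y)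
    (hXY : Y.card = X.card + 2) :
    (X.card + 2) * extCount n r k (X.card + 1) ≤
      (pairFamily r X Y).card + (X.card + 1) * extCount n r k (X.card + 2) := by
  classical
  have hp : pairFamily r X Y = (signedSets n r k).filter (· ∈ pairFamily r X Y) := by
    ext F
    rw [Finset.mem_filter]
    exact ⟨fun h => ⟨(mem_pairFamily.1 h).1, h⟩, fun h => h.2⟩
  have h1 : ∑ y ∈ Y, (signedSupersets r (Y.erase y)).card =
      (X.card + 2) * extCount n r k (X.card + 1) := by
    rw [← hXY, ← smul_eq_mul]
    refine Finset.sum_const_nat fun y hy => ?_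
    rw [(hY.mono (Finset.erase_subset y Y)).card_signedSupersets hrn,
      Finset.card_erase_of_mem hy, hXY]
    rfl
  have h2 : (signedSupersets r Y).card = extCount n r k (X.card + 2) := by
    rw [hY.card_signedSupersets hrn, hXY]
  rw [← h1, ← h2, hp]
  simp only [signedSupersets, Finset.card_filter, Finset.mul_sum]
  rw [Finset.sum_comm, ← Finset.sum_add_distrib]
  refine Finset.sum_le_sum fun F hF => ?_
  rw [← Finset.card_filter]
  by_cases hYF : Y ⊆ F
  · have hmem : F ∈ pairFamily r X Y := by
      refine mem_pairFamily.2 ⟨hF, Or.inl ⟨hsub.trans hYF, ?_⟩⟩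
      rw [Finset.inter_eq_right.2 hYF]
      omega
    rw [if_pos hmem, if_pos hYF]
    have := Finset.card_filter_le Y (fun y => Y.erase y ⊆ F)
    omega
  · obtain ⟨y₀, hy₀, hy₀F⟩ := Finset.not_subset.1 hYF
    have huniq : ∀ y ∈ Y.filter (fun y => Y.erase y ⊆ F), y = y₀ := by
      intro y hy
      by_contra hne
      exact hy₀F ((Finset.mem_filter.1 hy).2 (Finset.mem_erase.2 ⟨Ne.symm hne, hy₀⟩))
    rcases (Y.filter fun y => Y.erase y ⊆ F).eq_empty_or_nonempty with h | ⟨y, hy⟩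
    · rw [h]
      simp
    · have hsubF : Y.erase y₀ ⊆ F := by
        have := (Finset.mem_filter.1 hy).2
        rwa [huniq y hy] at this
      have hFY : F ∩ Y = Y.erase y₀ := by
        ext a
        rw [Finset.mem_inter, Finset.mem_erase]
        constructor
        · rintro ⟨h1, h2⟩
          exact ⟨fun h => hy₀F (h ▸ h1), h2⟩
        · rintro ⟨h1, h2⟩
          exact ⟨hsubF (Finset.mem_erase.2 ⟨h1, h2⟩), h2⟩
      have hc : (F ∩ Y).card = X.card + 1 := by
        rw [hFY, Finset.card_erase_of_mem hy₀]
        omega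
      have hmem : F ∈ pairFamily r X Y := by
        refine mem_pairFamily.2 ⟨hF, ?_⟩
        by_cases hXF : X ⊆ F
        · exact Or.inl ⟨hXF, hc.ge⟩
        · exact Or.inr ⟨hXF, by omega⟩
      rw [if_pos hmem]
      have : (Y.filter fun y => Y.erase y ⊆ F).card ≤ 1 :=
        Finset.card_le_one.2 fun a ha b hb => (huniq a ha).trans (huniq b hb).symm
      omega

lemma sum_card_signedSupersets_insert (hrn : r ≤ n) {Z : Finset (Fin n × Fin k)}
    (hXZ : Disjoint X Z) (hs : IsSigned (X ∪ Z)) :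
    ∑ F ∈ signedSupersets r X, (F ∩ Z).card = Z.card * extCount n r k (X.card + 1) := by
  classical
  rw [← sum_card_filter_mem]
  refine Finset.sum_const_nat fun z hz => ?_
  have hzX : z ∉ X := fun h => Finset.disjoint_left.1 hXZ h hz
  rw [filter_mem_signedSupersets, IsSigned.card_signedSupersets hrn,
    Finset.card_insert_of_notMem hzX]
  exact hs.mono (Finset.insert_subset (Finset.mem_union_right _ hz) Finset.subset_union_left)

/-- A Bonferroni inequality for the members that contain `X` and meet `Y \ X`. -/
lemma extCount_le_card_pairFamily_add_choose (hrn : r ≤ n) (hY : IsSigned Y) (hsub : X ⊆ Y)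
    {e : ℕ} (hXY : Y.card = X.card + e) :
    e * extCount n r k (X.card + 1) ≤
      (pairFamily r X Y).card + e.choose 2 * extCount n r k (X.card + 2) := by
  classical
  have hZ : (Y \ X).card = e := by
    rw [Finset.card_sdiff_of_subset hsub]
    omega
  have h1 := sum_card_signedSupersets_insert (r := r) hrn (Finset.disjoint_sdiff (s := X) (t := Y))
    (by rwa [Finset.union_sdiff_of_subset hsub])
  have h2 : ∑ P ∈ (Y \ X).powersetCard 2, (signedSupersets r (X ∪ P)).card =
      e.choose 2 * extCount n r k (X.card + 2) := by
    rw [← hZ, ← Finset.card_powersetCard]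
    refine Finset.sum_const_nat fun P hP => ?_
    obtain ⟨hPZ, hPc⟩ := Finset.mem_powersetCard.1 hP
    rw [IsSigned.card_signedSupersets hrn, Finset.card_union_of_disjoint, hPc]
    · exact Finset.disjoint_of_subset_right hPZ Finset.disjoint_sdiff
    · exact hY.mono (Finset.union_subset hsub (hPZ.trans Finset.sdiff_subset))
  have h3 : ∑ P ∈ (Y \ X).powersetCard 2, (signedSupersets r (X ∪ P)).card =
      ∑ F ∈ signedSupersets r X, (F ∩ (Y \ X)).card.choose 2 := by
    have h4 : ∀ P : Finset (Fin n × Fin k), signedSupersets r (X ∪ P) =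
        (signedSupersets r X).filter (P ⊆ ·) := by
      intro P
      ext F
      simp only [mem_signedSupersets, Finset.mem_filter, Finset.union_subset_iff]
      tauto
    simp only [h4, Finset.card_filter]
    rw [Finset.sum_comm]
    refine Finset.sum_congr rfl fun F _ => ?_
    rw [← Finset.card_filter, ← Finset.card_powersetCard]
    congr 1
    ext P
    simp only [Finset.mem_filter, Finset.mem_powersetCard, Finset.subset_inter_iff]
    tauto
  have h5 : ((signedSupersets r X).filter (· ∈ pairFamily r X Y)).card ≤
      (pairFamily r X Y).card :=
    Finset.card_le_card fun F hF => (Finset.mem_filter.1 hF).2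
  rw [hZ] at h1
  rw [← h1, ← h2, h3]
  refine le_trans ?_ (Nat.add_le_add_right h5 _)
  rw [Finset.card_filter, ← Finset.sum_add_distrib]
  refine Finset.sum_le_sum fun F hF => ?_
  obtain ⟨hF, hXF⟩ := mem_signedSupersets.1 hF
  rcases Nat.eq_zero_or_pos (F ∩ (Y \ X)).card with h | h
  · rw [h]
    exact Nat.zero_le _
  · have hmem : F ∈ pairFamily r X Y := by
      refine mem_pairFamily.2 ⟨hF, Or.inl ⟨hXF, ?_⟩⟩
      have : X ∪ (F ∩ (Y \ X)) ⊆ F ∩ Y := Finset.union_subset (Finset.subset_inter hXF hsub)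
        (Finset.inter_subset_inter_left Finset.sdiff_subset)
      have hle := Finset.card_le_card this
      rw [Finset.card_union_of_disjoint (Finset.disjoint_of_subset_right
        Finset.inter_subset_right Finset.disjoint_sdiff)] at hle
      omega
    rw [if_pos hmem]
    obtain ⟨j, hj⟩ : ∃ j, (F ∩ (Y \ X)).card = j + 1 := ⟨_, (Nat.sub_add_cancel h).symm⟩
    rw [hj, Nat.choose_succ_succ' j 1, Nat.choose_one_right]
    omega

end PairFamily

/-! ### Covers of a largest non-trivial family -/

/-- A `t`-cover of a family: a signed set that has at least `t` elements in common with every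
member. -/
def IsCover {n k : ℕ} (t : ℕ) (𝓕 : Finset (Finset (Fin n × Fin k)))
    (C : Finset (Fin n × Fin k)) : Prop :=
  IsSigned C ∧ ∀ F ∈ 𝓕, t ≤ (C ∩ F).card

section Covers

variable {n r k t : ℕ} {𝓕 : Finset (Finset (Fin n × Fin k))} {C D S : Finset (Fin n × Fin k)}

lemma IsNontrivialTIntersecting.not_isCover (h : IsNontrivialTIntersecting n r k t 𝓕)
    (hC : C.card = t) : ¬ IsCover t 𝓕 C := by
  rintro ⟨hs, hc⟩
  refine h.2.2 ⟨C, mem_signedSets.2 ⟨hC, hs⟩, fun F hF => ?_⟩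
  have : C ∩ F = C :=
    Finset.eq_of_subset_of_card_le Finset.inter_subset_left (hC.le.trans (hc F hF))
  exact Finset.inter_eq_left.1 this

lemma IsNontrivialTIntersecting.nonempty (h : IsNontrivialTIntersecting n r k t 𝓕)
    (hk : 2 ≤ k) (htr : t ≤ r) (hrn : r ≤ n) : 𝓕.Nonempty := by
  rw [Finset.nonempty_iff_ne_empty]
  rintro rfl
  have h0 : IsSigned (∅ : Finset (Fin n × Fin k)) := by
    intro a ha
    simp at ha
  obtain ⟨S, hS, -, -⟩ := h0.exists_extension (r := t) hk (htr.trans hrn) (by simp) h0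
  exact h.2.2 ⟨S, hS, by simp⟩

/-- By maximality, every signed `r`-set that contains a `t`-cover is a member. -/
lemma IsLargestNontrivialTIntersecting.mem_of_isCover
    (h : IsLargestNontrivialTIntersecting n r k t 𝓕) (htr : t ≤ r) (hC : IsCover t 𝓕 C)
    {G : Finset (Fin n × Fin k)} (hG : G ∈ signedSets n r k) (hCG : C ⊆ G) : G ∈ 𝓕 := by
  classical
  by_contra hG'
  have hGF : ∀ F ∈ 𝓕, t ≤ (G ∩ F).card := fun F hF =>
    (hC.2 F hF).trans (Finset.card_le_card (Finset.inter_subset_inter_right hCG))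
  have hle := h.2 (insert G 𝓕) ⟨Finset.insert_subset hG h.1.1, ?_, ?_⟩
  · rw [Finset.card_insert_of_notMem hG'] at hle
    omega
  · intro A hA B hB
    rcases Finset.mem_insert.1 hA with hA | hA <;> rcases Finset.mem_insert.1 hB with hB | hB
    · rwa [hA, hB, Finset.inter_self, (mem_signedSets.1 hG).1]
    · rw [hA]
      exact hGF B hB
    · rw [hB, Finset.inter_comm]
      exact hGF A hA
    · exact h.1.2.1 A hA B hB
  · rintro ⟨S, hS, hSF⟩
    exact h.1.2.2 ⟨S, hS, fun A hA => hSF A (Finset.mem_insert_of_mem hA)⟩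

/-- Two `t`-covers of size at most `r` have `t` elements in common: since `k ≥ 2`, they extend to
members that meet only in the intersection of the two covers. -/
lemma IsLargestNontrivialTIntersecting.le_card_inter_of_isCover
    (h : IsLargestNontrivialTIntersecting n r k t 𝓕) (hk : 2 ≤ k) (htr : t ≤ r) (hrn : r ≤ n)
    (hC : IsCover t 𝓕 C) (hD : IsCover t 𝓕 D) (hCr : C.card ≤ r) (hDr : D.card ≤ r) :
    t ≤ (C ∩ D).card := by
  obtain ⟨F, hF, hCF, hFD⟩ := hC.1.exists_extension hk hrn hCr hD.1
  obtain ⟨G, hG, hDG, hGF⟩ := hD.1.exists_extension hk hrn hDr (mem_signedSets.1 hF).2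
  refine (h.1.2.1 F (h.mem_of_isCover htr hC hF hCF) G
    (h.mem_of_isCover htr hD hG hDG)).trans (Finset.card_le_card ?_)
  intro a ha
  obtain ⟨haF, haG⟩ := Finset.mem_inter.1 ha
  have haD := hGF (Finset.mem_inter.2 ⟨haG, haF⟩)
  exact Finset.mem_inter.2 ⟨hFD (Finset.mem_inter.2 ⟨haF, haD⟩), haD⟩

lemma IsLargestNontrivialTIntersecting.eq_of_subset
    (h : IsLargestNontrivialTIntersecting n r k t 𝓕) {𝓖 : Finset (Finset (Fin n × Fin k))}
    (h𝓖 : IsNontrivialTIntersecting n r k t 𝓖) (hsub : 𝓕 ⊆ 𝓖) : 𝓕 = 𝓖 :=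
  Finset.eq_of_subset_of_card_le hsub (h.2 𝓖 h𝓖)

/-! ### Branching at a set that is not a cover -/

/-- If `S` is not a `t`-cover, then `r + 1 - t` elements suffice to meet all members containing
`S`. A member `F` with `|F ∩ S| = j < t` meets each of them in `t - j` elements outside `S`, so
`t - 1 - j` of the `r - j` elements of `F \ S` may be dropped. -/
lemma exists_branching_set (h𝓕 : 𝓕 ⊆ signedSets n r k) (ht : IsTIntersecting t 𝓕)
    {F : Finset (Fin n × Fin k)} (hF : F ∈ 𝓕) (hFS : (S ∩ F).card < t) :
    ∃ W : Finset (Fin n × Fin k), W.card ≤ r + 1 - t ∧ Disjoint W S ∧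
      ∀ G ∈ 𝓕, S ⊆ G → ∃ w ∈ W, w ∈ G := by
  classical
  have hFr := (mem_signedSets.1 (h𝓕 hF)).1
  have htr : t ≤ r := by
    have h1 := ht F hF F hF
    rwa [Finset.inter_self, hFr] at h1
  have hsd : (F \ S).card = r - (S ∩ F).card := by
    rw [← hFr, Finset.card_sdiff]
  obtain ⟨W, hWF, hW⟩ := Finset.exists_subset_card_eq (s := F \ S) (n := r + 1 - t) (by omega)
  refine ⟨W, hW.le, Finset.disjoint_of_subset_left hWF Finset.sdiff_disjoint, ?_⟩
  intro G hG hSG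
  by_contra! hno
  have hsub : G ∩ F ⊆ (S ∩ F) ∪ ((F \ S) \ W) := by
    intro a ha
    obtain ⟨haG, haF⟩ := Finset.mem_inter.1 ha
    by_cases haS : a ∈ S
    · exact Finset.mem_union_left _ (Finset.mem_inter.2 ⟨haS, haF⟩)
    · exact Finset.mem_union_right _ (Finset.mem_sdiff.2
        ⟨Finset.mem_sdiff.2 ⟨haF, haS⟩, fun h => hno a h haG⟩)
  have h1 := (ht G hG F hF).trans (Finset.card_le_card hsub)
  have h2 := h1.trans (Finset.card_union_le _ _)
  rw [Finset.card_sdiff_of_subset hWF, hsd, hW] at h2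
  omega

lemma card_filter_subset_le (h𝓕 : 𝓕 ⊆ signedSets n r k) (hrn : r ≤ n)
    (S : Finset (Fin n × Fin k)) : (𝓕.filter (S ⊆ ·)).card ≤ extCount n r k S.card :=
  (Finset.card_le_card (Finset.filter_subset_filter _ h𝓕)).trans (card_signedSupersets_le hrn S)

/-- A union bound: every member satisfies `P w` for some `w ∈ W`, and at most `N` members do so for
each single `w`. -/
lemma card_le_mul_of_cover {α β : Type*} [DecidableEq α] {𝓐 : Finset α} (W : Finset β) {N : ℕ}
    (P : β → α → Prop) [∀ w, DecidablePred (P w)] (hP : ∀ a ∈ 𝓐, ∃ w ∈ W, P w a)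
    (hN : ∀ w ∈ W, (𝓐.filter (P w)).card ≤ N) : 𝓐.card ≤ W.card * N := by
  refine le_trans (Finset.card_le_card ?_) (Finset.card_biUnion_le_card_mul W
    (fun w => 𝓐.filter (P w)) N hN)
  intro a ha
  obtain ⟨w, hw, h⟩ := hP a ha
  exact Finset.mem_biUnion.2 ⟨w, hw, Finset.mem_filter.2 ⟨ha, h⟩⟩

/-- Iterated branching: if no set of fewer than `s` elements containing `S` is a `t`-cover, then at
most `(r + 1 - t) ^ (s - |S|) * N(s)` members contain `S`. -/
lemma card_filter_subset_le_pow (h𝓕 : 𝓕 ⊆ signedSets n r k) (ht : IsTIntersecting t 𝓕)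
    (hrn : r ≤ n) {s : ℕ} (j : ℕ) (hS : S.card + j = s)
    (hno : ∀ C, S ⊆ C → C.card < s → ¬ IsCover t 𝓕 C) :
    (𝓕.filter (S ⊆ ·)).card ≤ (r + 1 - t) ^ j * extCount n r k s := by
  classical
  induction j generalizing S with
  | zero =>
    rw [pow_zero, one_mul, ← hS]
    exact card_filter_subset_le h𝓕 hrn S
  | succ j ih =>
    by_cases hs : IsSigned S
    · have hnc := hno S subset_rfl (by omega)
      have : ∃ F ∈ 𝓕, (S ∩ F).card < t := by
        by_contra! h
        exact hnc ⟨hs, h⟩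
      obtain ⟨F, hF, hFS⟩ := this
      obtain ⟨W, hW, hWS, hWF⟩ := exists_branching_set h𝓕 ht hF hFS
      have h1 := card_le_mul_of_cover (𝓐 := 𝓕.filter (S ⊆ ·)) W
        (N := (r + 1 - t) ^ j * extCount n r k s) (fun w G => w ∈ G)
        (fun G hG => hWF G (Finset.mem_filter.1 hG).1 (Finset.mem_filter.1 hG).2) ?_
      · refine h1.trans ?_
        rw [pow_succ', mul_assoc]
        exact Nat.mul_le_mul_right _ hW
      · intro w hw
        have hwS : w ∉ S := Finset.disjoint_left.1 hWS hw
        have hc := Finset.card_insert_of_notMem hwS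
        refine le_trans (Finset.card_le_card ?_) (ih (S := insert w S) (by omega)
          (fun C hC => hno C ((Finset.subset_insert w S).trans hC)))
        intro G hG
        obtain ⟨hG, hwG⟩ := Finset.mem_filter.1 hG
        obtain ⟨hG, hSG⟩ := Finset.mem_filter.1 hG
        exact Finset.mem_filter.2 ⟨hG, Finset.insert_subset hwG hSG⟩
    · have : 𝓕.filter (S ⊆ ·) = ∅ := by
        rw [Finset.filter_eq_empty_iff]
        intro G hG hSG
        exact hs ((mem_signedSets.1 (h𝓕 hG)).2.mono hSG)
      rw [this]
      simp

lemma card_filter_subset_le_mul (h𝓕 : 𝓕 ⊆ signedSets n r k) (ht : IsTIntersecting t 𝓕)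
    (hrn : r ≤ n) (hS : ¬ IsCover t 𝓕 S) :
    (𝓕.filter (S ⊆ ·)).card ≤ (r + 1 - t) * extCount n r k (S.card + 1) := by
  have := card_filter_subset_le_pow h𝓕 ht hrn (S := S) 1 rfl (fun C hSC hC => by
    rwa [← Finset.eq_of_subset_of_card_le hSC (by omega)])
  rwa [pow_one] at this

/-- If `s` is the smallest size of a `t`-cover, branching from the `t`-subsets of a smallest cover
bounds the family; for `s ≥ t + 2` the bound decreases with `s`. -/
lemma card_le_of_no_small_cover (h : IsNontrivialTIntersecting n r k t 𝓕) (hk : 2 ≤ k)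
    (htr : t ≤ r) (hrn : r ≤ n)
    (hN : ∀ s, t + 1 ≤ s →
      (r + 3 - t) * (t + 2).choose 2 * extCount n r k (s + 1) ≤ extCount n r k s)
    (hno : ∀ C, C.card = t + 1 → ¬ IsCover t 𝓕 C) :
    𝓕.card ≤ (t + 2).choose 2 * (r + 1 - t) ^ 2 * extCount n r k (t + 2) := by
  classical
  obtain ⟨F₀, hF₀⟩ := h.nonempty hk htr hrn
  have hF₀' := mem_signedSets.1 (h.1 hF₀)
  have hex : ∃ s, ∃ C, C.card = s ∧ IsCover t 𝓕 C :=
    ⟨r, F₀, hF₀'.1, hF₀'.2, fun F hF => h.2.1 F₀ hF₀ F hF⟩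
  obtain ⟨C, hC, hCc⟩ := Nat.find_spec hex
  have hmin : ∀ D, D.card < Nat.find hex → ¬ IsCover t 𝓕 D :=
    fun D hD hDc => Nat.find_min hex hD ⟨D, rfl, hDc⟩
  generalize Nat.find hex = s at hC hmin
  have hts : t + 2 ≤ s := by
    have h1 : t ≤ C.card := (hCc.2 F₀ hF₀).trans (Finset.card_le_card Finset.inter_subset_left)
    have h2 : C.card ≠ t := fun h' => h.not_isCover h' hCc
    have h3 : C.card ≠ t + 1 := fun h' => hno C h' hCc
    omega
  have h1 : 𝓕.card ≤ s.choose t * ((r + 1 - t) ^ (s - t) * extCount n r k s) := by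
    rw [← hC, ← Finset.card_powersetCard]
    refine card_le_mul_of_cover _ (fun A F => A ⊆ F) ?_ ?_
    · intro F hF
      obtain ⟨A, hA, hAc⟩ := Finset.exists_subset_card_eq (hCc.2 F hF)
      exact ⟨A, Finset.mem_powersetCard.2 ⟨hA.trans Finset.inter_subset_left, hAc⟩,
        hA.trans Finset.inter_subset_right⟩
    · intro A hA
      obtain ⟨hAC, hAc⟩ := Finset.mem_powersetCard.1 hA
      exact card_filter_subset_le_pow h.1 h.2.1 hrn _ (by omega) (fun D _ hD => hmin D (by omega))
  refine h1.trans ?_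
  clear h1 hmin hC
  induction s, hts using Nat.le_induction with
  | base =>
    have : (t + 2).choose t = (t + 2).choose 2 := by
      rw [Nat.choose_symm_add]
    rw [this, Nat.add_sub_cancel_left, mul_assoc]
  | succ s hs ih =>
    refine le_trans ?_ ih
    obtain ⟨a, rfl⟩ : ∃ a, s = t + a := ⟨s - t, by omega⟩
    have e1 : t + a + 1 - t = a + 1 := by omega
    have e2 : t + a - t = a := by omega
    rw [e1, e2]
    have hsN := hN (t + a) (by omega)
    set d := r + 1 - t with hd
    have hd2 : r + 3 - t = d + 2 := by omega
    rw [hd2] at hsN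
    -- The identity `(a + 1) * C(t + a + 1, t) = (t + a + 1) * C(t + a, t)`.
    have hch : (a + 1) * (t + a + 1).choose t = (t + a + 1) * (t + a).choose t := by
      have := Nat.add_one_mul_choose_eq (t + a) a
      have e3 : (t + a).choose a = (t + a).choose t := (Nat.choose_symm_add).symm
      have e4 : (t + a + 1).choose (a + 1) = (t + a + 1).choose t := by
        rw [add_assoc, ← Nat.choose_symm_add]
      rw [e3, e4] at this
      rw [this, mul_comm]
    have hC2 : (t + 1) ≤ (t + 2).choose 2 := by
      rw [Nat.choose_succ_succ' (t + 1) 1, Nat.choose_one_right]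
      omega
    have hcoef : (t + a + 1) * d ≤ (a + 1) * ((d + 2) * (t + 2).choose 2) := by
      have h1 : t + a + 1 ≤ (a + 1) * (t + 1) := by nlinarith
      calc (t + a + 1) * d ≤ ((a + 1) * (t + 1)) * (d + 2) :=
            Nat.mul_le_mul h1 (Nat.le_add_right d 2)
        _ ≤ ((a + 1) * (t + 2).choose 2) * (d + 2) :=
          Nat.mul_le_mul_right _ (Nat.mul_le_mul_left _ hC2)
        _ = _ := by ring
    refine Nat.le_of_mul_le_mul_left (c := a + 1) ?_ (by omega)
    set B := extCount n r k (t + a + 1)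
    set A := extCount n r k (t + a)
    calc (a + 1) * ((t + a + 1).choose t * (d ^ (a + 1) * B))
        = ((a + 1) * (t + a + 1).choose t) * (d ^ (a + 1) * B) := by ring
      _ = (t + a).choose t * d ^ a * B * ((t + a + 1) * d) := by rw [hch]; ring
      _ ≤ (t + a).choose t * d ^ a * B * ((a + 1) * ((d + 2) * (t + 2).choose 2)) :=
        Nat.mul_le_mul_left _ hcoef
      _ = (a + 1) * ((t + a).choose t * (d ^ a * ((d + 2) * (t + 2).choose 2 * B))) := by ring
      _ ≤ (a + 1) * ((t + a).choose t * (d ^ a * A)) := by gcongr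

end Covers

/-! ### Covers of size `t + 1` -/

/-- A family of `(t + 1)`-sets that pairwise share `t` elements is a sunflower with a common
`t`-set, or three of its members lie in a common `(t + 2)`-set. -/
lemma exists_common_subset_or_three {α : Type*} [DecidableEq α] {𝓣 : Set (Finset α)} {t : ℕ}
    (hne : 𝓣.Nonempty) (hc : ∀ T ∈ 𝓣, T.card = t + 1)
    (hi : ∀ T ∈ 𝓣, ∀ T' ∈ 𝓣, t ≤ (T ∩ T').card) :
    (∃ X : Finset α, X.card = t ∧ ∀ T ∈ 𝓣, X ⊆ T) ∨
      ∃ T₁ ∈ 𝓣, ∃ T₂ ∈ 𝓣, ∃ T₃ ∈ 𝓣, (T₁ ∪ T₂).card = t + 2 ∧ T₃ ⊆ T₁ ∪ T₂ ∧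
        (T₁ ∩ T₂ ∩ T₃).card < t := by
  obtain ⟨T₁, h₁⟩ := hne
  by_cases hall : ∀ T ∈ 𝓣, T = T₁
  · obtain ⟨X, hX, hXc⟩ := Finset.exists_subset_card_eq (s := T₁) (n := t)
      (by rw [hc T₁ h₁]; omega)
    exact Or.inl ⟨X, hXc, fun T hT => hall T hT ▸ hX⟩
  push Not at hall
  obtain ⟨T₂, h₂, hne⟩ := hall
  have c₁ := hc T₁ h₁
  have c₂ := hc T₂ h₂
  have h12 : (T₁ ∩ T₂).card = t := by
    refine le_antisymm ?_ (hi T₁ h₁ T₂ h₂)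
    by_contra! hlt
    have e₁ : T₁ ∩ T₂ = T₁ :=
      Finset.eq_of_subset_of_card_le Finset.inter_subset_left (by omega)
    have e₂ : T₁ ∩ T₂ = T₂ :=
      Finset.eq_of_subset_of_card_le Finset.inter_subset_right (by omega)
    exact hne (e₂.symm.trans e₁)
  by_cases hX : ∀ T ∈ 𝓣, T₁ ∩ T₂ ⊆ T
  · exact Or.inl ⟨_, h12, hX⟩
  push Not at hX
  obtain ⟨T₃, h₃, hX⟩ := hX
  have h123 : (T₁ ∩ T₂ ∩ T₃).card < t := by
    rw [← h12]
    refine Finset.card_lt_card (Finset.ssubset_iff_subset_ne.2 ⟨Finset.inter_subset_left, ?_⟩)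
    exact fun h => hX (Finset.inter_eq_left.1 h)
  refine Or.inr ⟨T₁, h₁, T₂, h₂, T₃, h₃, ?_, ?_, h123⟩
  · have := Finset.card_union_add_card_inter T₁ T₂
    omega
  · have h := Finset.card_union_add_card_inter (T₁ ∩ T₃) (T₂ ∩ T₃)
    have e : T₁ ∩ T₃ ∩ (T₂ ∩ T₃) = T₁ ∩ T₂ ∩ T₃ := by
      ext a
      simp only [Finset.mem_inter]
      tauto
    rw [e, ← Finset.union_inter_distrib_right] at h
    have h13 := hi T₁ h₁ T₃ h₃
    have h23 := hi T₂ h₂ T₃ h₃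
    have c₃ := hc T₃ h₃
    exact Finset.inter_eq_right.1
      (Finset.eq_of_subset_of_card_le Finset.inter_subset_right (by omega))

section Structure

variable {n r k t : ℕ} {𝓕 : Finset (Finset (Fin n × Fin k))} {X : Finset (Fin n × Fin k)}

/-- Three covers in a common `(t + 2)`-set `Y` force every member to have `t + 1` elements of `Y`,
so the family lies in one of the extremal families. -/
lemma exists_subset_pairFamily_of_three (h𝓕 : 𝓕 ⊆ signedSets n r k)
    {T₁ T₂ T₃ : Finset (Fin n × Fin k)}
    (h₁ : IsCover t 𝓕 T₁) (h₂ : IsCover t 𝓕 T₂) (h₃ : IsCover t 𝓕 T₃)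
    (c₁ : T₁.card = t + 1) (c₂ : T₂.card = t + 1) (c₃ : T₃.card = t + 1)
    (hY : (T₁ ∪ T₂).card = t + 2) (h₃Y : T₃ ⊆ T₁ ∪ T₂) (h123 : (T₁ ∩ T₂ ∩ T₃).card < t) :
    ∃ X Y : Finset (Fin n × Fin k), IsSigned Y ∧ X ⊆ Y ∧ X.card = t ∧ Y.card = t + 2 ∧
      𝓕 ⊆ pairFamily r X Y := by
  classical
  have h12 : (T₁ ∩ T₂).card = t := by
    have := Finset.card_union_add_card_inter T₁ T₂
    omega
  -- The only element of `T₁ ∪ T₂` missing from `T₃` belongs to `T₁ ∩ T₂`.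
  have hmiss : ∀ a ∈ T₁ ∪ T₂, a ∉ T₁ ∩ T₂ → a ∈ T₃ := by
    intro a ha haX
    by_contra ha3
    obtain ⟨b, hb, hb3⟩ : ∃ b ∈ T₁ ∩ T₂, b ∉ T₃ := by
      by_contra! hall
      rw [Finset.inter_eq_left.2 hall] at h123
      omega
    have hone : ((T₁ ∪ T₂) \ T₃).card ≤ 1 := by
      rw [Finset.card_sdiff_of_subset h₃Y]
      omega
    have := Finset.card_le_one.1 hone a (Finset.mem_sdiff.2 ⟨ha, ha3⟩) b
      (Finset.mem_sdiff.2 ⟨Finset.mem_union_left _ (Finset.mem_inter.1 hb).1, hb3⟩)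
    exact haX (this ▸ hb)
  have hYs : IsSigned (T₁ ∪ T₂) := by
    intro a ha b hb hab
    by_cases haX : a ∈ T₁ ∩ T₂
    · obtain ⟨ha₁, ha₂⟩ := Finset.mem_inter.1 haX
      rcases Finset.mem_union.1 hb with hb | hb
      · exact h₁.1 a ha₁ b hb hab
      · exact h₂.1 a ha₂ b hb hab
    · by_cases hbX : b ∈ T₁ ∩ T₂
      · obtain ⟨hb₁, hb₂⟩ := Finset.mem_inter.1 hbX
        rcases Finset.mem_union.1 ha with ha | ha
        · exact h₁.1 a ha b hb₁ hab
        · exact h₂.1 a ha b hb₂ hab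
      · exact h₃.1 a (hmiss a ha haX) b (hmiss b hb hbX) hab
  refine ⟨T₁ ∩ T₂, T₁ ∪ T₂, hYs, Finset.inter_subset_left.trans Finset.subset_union_left, h12,
    hY, ?_⟩
  intro F hF
  have hlow : t + 1 ≤ (F ∩ (T₁ ∪ T₂)).card := by
    by_contra! hlt
    have key : ∀ T, IsCover t 𝓕 T → T ⊆ T₁ ∪ T₂ → F ∩ (T₁ ∪ T₂) ⊆ T := by
      intro T hT hTY
      have e : T ∩ F = F ∩ (T₁ ∪ T₂) := Finset.eq_of_subset_of_card_le
        (fun a ha => Finset.mem_inter.2 ⟨(Finset.mem_inter.1 ha).2, hTY (Finset.mem_inter.1 ha).1⟩)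
        (by have := hT.2 F hF; omega)
      rw [← e]
      exact Finset.inter_subset_left
    have h4 : F ∩ (T₁ ∪ T₂) ⊆ T₁ ∩ T₂ ∩ T₃ := Finset.subset_inter (Finset.subset_inter
      (key T₁ h₁ Finset.subset_union_left) (key T₂ h₂ Finset.subset_union_right)) (key T₃ h₃ h₃Y)
    have h5 := Finset.card_le_card h4
    have h6 : T₁ ∩ F ⊆ F ∩ (T₁ ∪ T₂) := fun a ha => Finset.mem_inter.2
      ⟨(Finset.mem_inter.1 ha).2, Finset.mem_union_left _ (Finset.mem_inter.1 ha).1⟩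
    have h7 := (h₁.2 F hF).trans (Finset.card_le_card h6)
    omega
  refine mem_pairFamily.2 ⟨h𝓕 hF, ?_⟩
  rw [h12, hY]
  by_cases hXF : T₁ ∩ T₂ ⊆ F
  · exact Or.inl ⟨hXF, hlow⟩
  · refine Or.inr ⟨hXF, ?_⟩
    have h8 : (F ∩ (T₁ ∪ T₂)).card ≠ t + 2 := by
      intro h8
      have : F ∩ (T₁ ∪ T₂) = T₁ ∪ T₂ :=
        Finset.eq_of_subset_of_card_le Finset.inter_subset_right (by omega)
      exact hXF ((Finset.inter_subset_left.trans Finset.subset_union_left).trans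
        (Finset.inter_eq_right.1 this))
    have h9 : (F ∩ (T₁ ∪ T₂)).card ≤ t + 2 := hY ▸ Finset.card_le_card Finset.inter_subset_right
    omega

/-! ### A sunflower of covers -/

open Classical in
/-- The elements that extend `X` to a `t`-cover with one more element. -/
noncomputable def coverPetals (t : ℕ) (𝓕 : Finset (Finset (Fin n × Fin k)))
    (X : Finset (Fin n × Fin k)) : Finset (Fin n × Fin k) :=
  Finset.univ.filter fun z => z ∉ X ∧ IsCover t 𝓕 (insert z X)

lemma mem_coverPetals {z : Fin n × Fin k} :
    z ∈ coverPetals t 𝓕 X ↔ z ∉ X ∧ IsCover t 𝓕 (insert z X) := by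
  simp [coverPetals]

lemma disjoint_coverPetals : Disjoint X (coverPetals t 𝓕 X) :=
  Finset.disjoint_right.2 fun _ hz => (mem_coverPetals.1 hz).1

lemma coverPetals_subset (hX : X.card = t) {F : Finset (Fin n × Fin k)} (hF : F ∈ 𝓕)
    (hXF : ¬ X ⊆ F) : coverPetals t 𝓕 X ⊆ F := by
  intro z hz
  by_contra hzF
  have h1 := (mem_coverPetals.1 hz).2.2 F hF
  rw [Finset.insert_inter_of_notMem hzF] at h1
  exact hXF (Finset.inter_eq_left.1
    (Finset.eq_of_subset_of_card_le Finset.inter_subset_left (by omega)))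

lemma card_inter_add_one (hX : X.card = t) (hZ : (coverPetals t 𝓕 X).Nonempty)
    {F : Finset (Fin n × Fin k)} (hF : F ∈ 𝓕) (hXF : ¬ X ⊆ F) : (F ∩ X).card + 1 = t := by
  classical
  obtain ⟨z, hz⟩ := hZ
  have hzF := coverPetals_subset hX hF hXF hz
  have h1 := (mem_coverPetals.1 hz).2.2 F hF
  rw [Finset.insert_inter_of_mem hzF, Finset.inter_comm X F] at h1
  have h2 := h1.trans (Finset.card_insert_le _ _)
  have h3 : (F ∩ X).card < X.card := by
    refine Finset.card_lt_card (Finset.ssubset_iff_subset_ne.2 ⟨Finset.inter_subset_right, ?_⟩)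
    exact fun h => hXF (Finset.inter_eq_right.1 h)
  omega

/-- Adding to `X` elements of one signed set that are each compatible with `X` gives a signed
set. -/
lemma isSigned_union_of_insert {A F : Finset (Fin n × Fin k)} (hX : IsSigned X)
    (hF : IsSigned F) (hAF : A ⊆ F) (hA : ∀ a ∈ A, IsSigned (insert a X)) :
    IsSigned (X ∪ A) := by
  have hmix : ∀ a ∈ A, ∀ x ∈ X, a.1 = x.1 → a = x := fun a ha x hx =>
    hA a ha a (Finset.mem_insert_self _ _) x (Finset.mem_insert_of_mem hx)
  intro a ha b hb hab
  rcases Finset.mem_union.1 ha with ha | ha <;> rcases Finset.mem_union.1 hb with hb | hb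
  · exact hX a ha b hb hab
  · exact (hmix b hb a ha hab.symm).symm
  · exact hmix a ha b hb hab
  · exact hF a (hAF ha) b (hAF hb) hab

/-- The elements that a member missing `X` has outside `X` and the petals, and that are compatible
with `X`. Together with `X` and the petals they form a signed set, which bounds their number. -/
lemma exists_compatible_set (h𝓕 : 𝓕 ⊆ signedSets n r k) (hX : X.card = t) (hXs : IsSigned X)
    (hZ : (coverPetals t 𝓕 X).Nonempty) {F₀ : Finset (Fin n × Fin k)} (hF₀ : F₀ ∈ 𝓕)
    (hXF₀ : ¬ X ⊆ F₀) :
    ∃ W : Finset (Fin n × Fin k), t + (coverPetals t 𝓕 X).card + W.card ≤ min (r + 1) n ∧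
      IsSigned (X ∪ coverPetals t 𝓕 X) ∧
      ∀ w, w ∈ W ↔ w ∈ F₀ ∧ w ∉ X ∧ w ∉ coverPetals t 𝓕 X ∧ IsSigned (insert w X) := by
  classical
  obtain ⟨hF₀r, hF₀s⟩ := mem_signedSets.1 (h𝓕 hF₀)
  have hZF := coverPetals_subset hX hF₀ hXF₀
  have hi := card_inter_add_one hX hZ hF₀ hXF₀
  set Z := coverPetals t 𝓕 X with hZdef
  set W := (F₀ \ (X ∪ Z)).filter fun w => IsSigned (insert w X) with hW
  have hWmem : ∀ w, w ∈ W ↔ w ∈ F₀ ∧ w ∉ X ∧ w ∉ Z ∧ IsSigned (insert w X) := by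
    intro w
    simp only [hW, Finset.mem_filter, Finset.mem_sdiff, Finset.mem_union]
    tauto
  have hWF : W ⊆ F₀ := fun w hw => ((hWmem w).1 hw).1
  have hXZ : Disjoint X Z := disjoint_coverPetals
  have hsZ : ∀ z ∈ Z, IsSigned (insert z X) := fun z hz => (mem_coverPetals.1 hz).2.1
  have hs : IsSigned (X ∪ (Z ∪ W)) := by
    refine isSigned_union_of_insert hXs hF₀s (Finset.union_subset hZF hWF) fun a ha => ?_
    rcases Finset.mem_union.1 ha with ha | ha
    · exact hsZ a ha
    · exact ((hWmem a).1 ha).2.2.2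
  have hZW : Disjoint Z W := Finset.disjoint_right.2 fun w hw => ((hWmem w).1 hw).2.2.1
  have hXW : Disjoint X W := Finset.disjoint_right.2 fun w hw => ((hWmem w).1 hw).2.1
  have hc1 : (X ∪ (Z ∪ W)).card = t + Z.card + W.card := by
    rw [Finset.card_union_of_disjoint (Finset.disjoint_union_right.2 ⟨hXZ, hXW⟩),
      Finset.card_union_of_disjoint hZW, hX, add_assoc]
  have hc2 : ((F₀ ∩ X) ∪ (Z ∪ W)).card = (F₀ ∩ X).card + (Z.card + W.card) := by
    rw [Finset.card_union_of_disjoint, Finset.card_union_of_disjoint hZW]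
    exact Finset.disjoint_of_subset_left Finset.inter_subset_right
      (Finset.disjoint_union_right.2 ⟨hXZ, hXW⟩)
  have hle := Finset.card_le_card
    (Finset.union_subset (Finset.inter_subset_left (s₁ := F₀) (s₂ := X))
      (Finset.union_subset hZF hWF))
  have hn := hs.card_le
  refine ⟨W, le_min (by omega) (by omega), ?_, hWmem⟩
  exact hs.mono (Finset.union_subset_union_right Finset.subset_union_left)

lemma exists_mem_of_disjoint_petals (h𝓕 : 𝓕 ⊆ signedSets n r k) (ht : IsTIntersecting t 𝓕)
    (hX : X.card = t) (hZ : (coverPetals t 𝓕 X).Nonempty) {F₀ W : Finset (Fin n × Fin k)}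
    (hF₀ : F₀ ∈ 𝓕) (hXF₀ : ¬ X ⊆ F₀)
    (hW : ∀ w, w ∈ W ↔ w ∈ F₀ ∧ w ∉ X ∧ w ∉ coverPetals t 𝓕 X ∧ IsSigned (insert w X))
    {F : Finset (Fin n × Fin k)} (hF : F ∈ 𝓕) (hXF : X ⊆ F)
    (hFZ : Disjoint F (coverPetals t 𝓕 X)) : ∃ w ∈ W, w ∈ F := by
  classical
  have hi := card_inter_add_one hX hZ hF₀ hXF₀
  obtain ⟨w, hw, hwX⟩ : ∃ w ∈ F ∩ F₀, w ∉ F₀ ∩ X := by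
    by_contra! hall
    have := (ht F hF F₀ hF₀).trans (Finset.card_le_card hall)
    omega
  obtain ⟨hwF, hwF₀⟩ := Finset.mem_inter.1 hw
  refine ⟨w, (hW w).2 ⟨hwF₀, fun h => hwX (Finset.mem_inter.2 ⟨hwF₀, h⟩),
    Finset.disjoint_left.1 hFZ hwF, ?_⟩, hwF⟩
  exact (mem_signedSets.1 (h𝓕 hF)).2.mono (Finset.insert_subset hwF hXF)

/-- If the number of petals is as large as possible, then the family lies in an extremal
family. -/
lemma subset_pairFamily_of_card_petals (h𝓕 : 𝓕 ⊆ signedSets n r k) (ht : IsTIntersecting t 𝓕)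
    (hX : X.card = t) (hXs : IsSigned X) (hZ : (coverPetals t 𝓕 X).Nonempty)
    {F₀ : Finset (Fin n × Fin k)} (hF₀ : F₀ ∈ 𝓕) (hXF₀ : ¬ X ⊆ F₀)
    (hmax : t + (coverPetals t 𝓕 X).card = min (r + 1) n) :
    𝓕 ⊆ pairFamily r X (X ∪ coverPetals t 𝓕 X) := by
  classical
  obtain ⟨W, hWc, -, hW⟩ := exists_compatible_set h𝓕 hX hXs hZ hF₀ hXF₀
  have hW0 : W = ∅ := Finset.card_eq_zero.1 (by omega)
  intro F hF
  refine mem_pairFamily.2 ⟨h𝓕 hF, ?_⟩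
  by_cases hXF : X ⊆ F
  · refine Or.inl ⟨hXF, ?_⟩
    by_cases hFZ : Disjoint F (coverPetals t 𝓕 X)
    · obtain ⟨w, hw, -⟩ := exists_mem_of_disjoint_petals h𝓕 ht hX hZ hF₀ hXF₀ hW hF hXF hFZ
      rw [hW0] at hw
      simp at hw
    · obtain ⟨z, hzF, hzZ⟩ := Finset.not_disjoint_iff.1 hFZ
      rw [← Finset.card_insert_of_notMem (mem_coverPetals.1 hzZ).1]
      refine Finset.card_le_card (Finset.insert_subset ?_ ?_)
      · exact Finset.mem_inter.2 ⟨hzF, Finset.mem_union_right _ hzZ⟩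
      · exact Finset.subset_inter hXF Finset.subset_union_left
  · refine Or.inr ⟨hXF, ?_⟩
    have h1 := card_inter_add_one hX hZ hF hXF
    rw [Finset.inter_union_distrib_left, Finset.card_union_of_disjoint,
      Finset.inter_eq_right.2 (coverPetals_subset hX hF hXF),
      Finset.card_union_of_disjoint disjoint_coverPetals]
    · omega
    · exact Finset.disjoint_of_subset_left Finset.inter_subset_right
        (Finset.disjoint_of_subset_right Finset.inter_subset_right disjoint_coverPetals)

/-! ### Upper bounds for a sunflower of covers -/

open Classical in
lemma card_filter_meets_petals_le (h𝓕 : 𝓕 ⊆ signedSets n r k) (hrn : r ≤ n) (hX : X.card = t) :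
    (𝓕.filter fun F => X ⊆ F ∧ ¬ Disjoint F (coverPetals t 𝓕 X)).card ≤
      (coverPetals t 𝓕 X).card * extCount n r k (t + 1) := by
  refine card_le_mul_of_cover _ (fun z F => z ∈ F) ?_ ?_
  · intro F hF
    obtain ⟨z, hzF, hzZ⟩ := Finset.not_disjoint_iff.1 (Finset.mem_filter.1 hF).2.2
    exact ⟨z, hzZ, hzF⟩
  · intro z hz
    rw [← hX, ← Finset.card_insert_of_notMem (mem_coverPetals.1 hz).1]
    refine le_trans (Finset.card_le_card ?_) (card_filter_subset_le h𝓕 hrn _)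
    intro F hF
    obtain ⟨hF, hzF⟩ := Finset.mem_filter.1 hF
    obtain ⟨hF, hXF, -⟩ := Finset.mem_filter.1 hF
    exact Finset.mem_filter.2 ⟨hF, Finset.insert_subset hzF hXF⟩

open Classical in
lemma card_filter_disjoint_petals_le (h𝓕 : 𝓕 ⊆ signedSets n r k) (ht : IsTIntersecting t 𝓕)
    (hrn : r ≤ n) (hX : X.card = t) (hXs : IsSigned X) (hZ : (coverPetals t 𝓕 X).Nonempty)
    {F₀ : Finset (Fin n × Fin k)} (hF₀ : F₀ ∈ 𝓕) (hXF₀ : ¬ X ⊆ F₀) :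
    (𝓕.filter fun F => X ⊆ F ∧ Disjoint F (coverPetals t 𝓕 X)).card ≤
      (min (r + 1) n - t - (coverPetals t 𝓕 X).card) *
        ((r + 1 - t) * extCount n r k (t + 2)) := by
  obtain ⟨W, hWc, -, hW⟩ := exists_compatible_set h𝓕 hX hXs hZ hF₀ hXF₀
  refine le_trans (card_le_mul_of_cover W (N := (r + 1 - t) * extCount n r k (t + 2))
    (fun w F => w ∈ F) ?_ ?_) (Nat.mul_le_mul_right _ (by omega))
  · intro F hF
    obtain ⟨hF, hXF, hFZ⟩ := Finset.mem_filter.1 hF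
    exact exists_mem_of_disjoint_petals h𝓕 ht hX hZ hF₀ hXF₀ hW hF hXF hFZ
  · intro w hw
    obtain ⟨-, hwX, hwZ, -⟩ := (hW w).1 hw
    have hnc : ¬ IsCover t 𝓕 (insert w X) := fun h => hwZ (mem_coverPetals.2 ⟨hwX, h⟩)
    have hc := Finset.card_insert_of_notMem hwX
    have hle := card_filter_subset_le_mul h𝓕 ht hrn hnc
    rw [hc, hX] at hle
    refine le_trans (Finset.card_le_card ?_) hle
    intro F hF
    obtain ⟨hF, hwF⟩ := Finset.mem_filter.1 hF
    obtain ⟨hF, hXF, -⟩ := Finset.mem_filter.1 hF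
    exact Finset.mem_filter.2 ⟨hF, Finset.insert_subset hwF hXF⟩

open Classical in
/-- A member that does not contain `X` contains all petals and all but one element of `X`. -/
lemma card_filter_not_subset_le (hX : X.card = t) (hZ : (coverPetals t 𝓕 X).Nonempty) {N : ℕ}
    (hN : ∀ x ∈ X, (𝓕.filter (X.erase x ∪ coverPetals t 𝓕 X ⊆ ·)).card ≤ N) :
    (𝓕.filter fun F => ¬ X ⊆ F).card ≤ t * N := by
  rw [← hX]
  refine card_le_mul_of_cover X
    (fun x F => X.erase x ∪ coverPetals t 𝓕 X ⊆ F) ?_ ?_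
  · intro F hF
    obtain ⟨hF, hXF⟩ := Finset.mem_filter.1 hF
    obtain ⟨x, hx, hxF⟩ := Finset.not_subset.1 hXF
    refine ⟨x, hx, Finset.union_subset ?_ (coverPetals_subset hX hF hXF)⟩
    have h1 := card_inter_add_one hX hZ hF hXF
    have h2 : F ∩ X = X.erase x := by
      refine Finset.eq_of_subset_of_card_le (fun a ha => ?_) ?_
      · obtain ⟨haF, haX⟩ := Finset.mem_inter.1 ha
        exact Finset.mem_erase.2 ⟨fun h => hxF (h ▸ haF), haX⟩
      · rw [Finset.card_erase_of_mem hx]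
        omega
    rw [← h2]
    exact Finset.inter_subset_left
  · intro x hx
    exact (Finset.card_le_card
      (Finset.filter_subset_filter _ (Finset.filter_subset _ _))).trans (hN x hx)

lemma card_erase_union_coverPetals (hX : X.card = t) {x : Fin n × Fin k} (hx : x ∈ X) :
    (X.erase x ∪ coverPetals t 𝓕 X).card + 1 = t + (coverPetals t 𝓕 X).card := by
  rw [Finset.card_union_of_disjoint
    (Finset.disjoint_of_subset_left (Finset.erase_subset _ _) disjoint_coverPetals),
    Finset.card_erase_of_mem hx, hX]
  have : 0 < X.card := Finset.card_pos.2 ⟨x, hx⟩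
  omega

open Classical in
lemma card_eq_sum_filter_petals (X : Finset (Fin n × Fin k)) :
    𝓕.card = (𝓕.filter fun F => X ⊆ F ∧ ¬ Disjoint F (coverPetals t 𝓕 X)).card +
      (𝓕.filter fun F => X ⊆ F ∧ Disjoint F (coverPetals t 𝓕 X)).card +
      (𝓕.filter fun F => ¬ X ⊆ F).card := by
  have h1 := Finset.card_filter_add_card_filter_not (s := 𝓕) (fun F => X ⊆ F)
  have h2 := Finset.card_filter_add_card_filter_not (s := 𝓕.filter fun F => X ⊆ F)
    (fun F => Disjoint F (coverPetals t 𝓕 X))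
  rw [Finset.filter_filter, Finset.filter_filter] at h2
  omega

/-- The bound for exactly two petals. The sets `X \ {x}` together with the petals have `t + 1`
elements and do not contain `X`, hence are not covers. -/
lemma card_le_of_two_petals (h𝓕 : 𝓕 ⊆ signedSets n r k) (ht : IsTIntersecting t 𝓕)
    (hrn : r ≤ n) (hX : X.card = t) (hXs : IsSigned X)
    (hcov : ∀ T, T.card = t + 1 → IsCover t 𝓕 T → X ⊆ T)
    (hZ : (coverPetals t 𝓕 X).card = 2)
    {F₀ : Finset (Fin n × Fin k)} (hF₀ : F₀ ∈ 𝓕) (hXF₀ : ¬ X ⊆ F₀) :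
    𝓕.card ≤ 2 * extCount n r k (t + 1) +
      (min (r + 1) n - t - 2) * ((r + 1 - t) * extCount n r k (t + 2)) +
      t * ((r + 1 - t) * extCount n r k (t + 2)) := by
  classical
  have hZne : (coverPetals t 𝓕 X).Nonempty := Finset.card_pos.1 (by omega)
  have h1 := card_filter_meets_petals_le h𝓕 hrn hX
  have h2 := card_filter_disjoint_petals_le h𝓕 ht hrn hX hXs hZne hF₀ hXF₀
  rw [hZ] at h1 h2
  rw [card_eq_sum_filter_petals (t := t) X]
  refine Nat.add_le_add (Nat.add_le_add h1 h2) (card_filter_not_subset_le hX hZne ?_)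
  intro x hx
  have hc := card_erase_union_coverPetals (𝓕 := 𝓕) hX hx
  have hle := card_filter_subset_le_mul h𝓕 ht hrn
    (S := X.erase x ∪ coverPetals t 𝓕 X) fun hcv => by
      rcases Finset.mem_union.1 (hcov _ (by omega) hcv hx) with h | h
      · exact Finset.notMem_erase x X h
      · exact (mem_coverPetals.1 h).1 hx
  have e : (X.erase x ∪ coverPetals t 𝓕 X).card + 1 = t + 2 := by omega
  rwa [e] at hle

lemma card_le_of_three_le_petals (h𝓕 : 𝓕 ⊆ signedSets n r k) (ht : IsTIntersecting t 𝓕)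
    (hrn : r ≤ n) (hX : X.card = t) (hXs : IsSigned X) {h s : ℕ}
    (hZ : (coverPetals t 𝓕 X).card = h) (hh : 3 ≤ h)
    {F₀ : Finset (Fin n × Fin k)} (hF₀ : F₀ ∈ 𝓕) (hXF₀ : ¬ X ⊆ F₀)
    (hN : extCount n r k (t + h - 1) ≤ extCount n r k s) :
    𝓕.card ≤ h * extCount n r k (t + 1) +
      (min (r + 1) n - t - h) * ((r + 1 - t) * extCount n r k (t + 2)) +
      t * extCount n r k s := by
  classical
  have hZne : (coverPetals t 𝓕 X).Nonempty := Finset.card_pos.1 (by omega)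
  have h1 := card_filter_meets_petals_le h𝓕 hrn hX
  have h2 := card_filter_disjoint_petals_le h𝓕 ht hrn hX hXs hZne hF₀ hXF₀
  rw [hZ] at h1 h2
  rw [card_eq_sum_filter_petals (t := t) X]
  refine Nat.add_le_add (Nat.add_le_add h1 h2) (card_filter_not_subset_le hX hZne ?_)
  intro x hx
  have hc := card_erase_union_coverPetals (𝓕 := 𝓕) hX hx
  refine (card_filter_subset_le h𝓕 hrn _).trans (le_trans (le_of_eq ?_) hN)
  congr 1
  omega

/-- The bound for a single cover `T` of size `t + 1`: a member that does not contain `T` contains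
all of `T` but one element `x`, and branching twice from `T \ {x}` never reaches `T`. -/
lemma card_le_of_unique_cover (h : IsNontrivialTIntersecting n r k t 𝓕) (hrn : r ≤ n)
    {T : Finset (Fin n × Fin k)} (hT : IsCover t 𝓕 T) (hTc : T.card = t + 1)
    (huniq : ∀ T', T'.card = t + 1 → IsCover t 𝓕 T' → T' = T) :
    𝓕.card ≤ extCount n r k (t + 1) +
      (t + 1) * ((r + 1 - t) * ((r + 1 - t) * extCount n r k (t + 2))) := by
  classical
  rw [← Finset.card_filter_add_card_filter_not (s := 𝓕) (fun F => T ⊆ F)]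
  refine Nat.add_le_add (hTc ▸ card_filter_subset_le h.1 hrn T) ?_
  rw [← hTc]
  refine card_le_mul_of_cover T (fun x F => x ∉ F) ?_ ?_
  · intro F hF
    exact Finset.not_subset.1 (Finset.mem_filter.1 hF).2
  intro x hx
  have hSc : (T.erase x).card = t := by
    rw [Finset.card_erase_of_mem hx]
    omega
  have hSs : IsSigned (T.erase x) := hT.1.mono (Finset.erase_subset _ _)
  obtain ⟨F₁, hF₁, hF₁S⟩ : ∃ F ∈ 𝓕, (T.erase x ∩ F).card < t := by
    by_contra! hall
    exact h.not_isCover hSc ⟨hSs, hall⟩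
  obtain ⟨W, hWc, hWS, hW⟩ := exists_branching_set h.1 h.2.1 hF₁ hF₁S
  have hsub : ∀ F ∈ 𝓕, x ∉ F → T.erase x ⊆ F := by
    intro F hF hxF
    have e : T ∩ F = T.erase x := by
      refine Finset.eq_of_subset_of_card_le (fun a ha => ?_) (hSc.le.trans (hT.2 F hF))
      obtain ⟨haT, haF⟩ := Finset.mem_inter.1 ha
      exact Finset.mem_erase.2 ⟨fun h => hxF (h ▸ haF), haT⟩
    rw [← e]
    exact Finset.inter_subset_right
  rw [Finset.filter_filter]
  refine le_trans (card_le_mul_of_cover W (N := (r + 1 - t) * extCount n r k (t + 2))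
    (fun w F => w ∈ F) ?_ ?_) (Nat.mul_le_mul_right _ hWc)
  · intro F hF
    obtain ⟨hF, -, hxF⟩ := Finset.mem_filter.1 hF
    exact hW F hF (hsub F hF hxF)
  · intro w hw
    rw [Finset.filter_filter]
    by_cases hwx : w = x
    · rw [Finset.filter_false_of_mem]
      · simp
      · rintro F - ⟨⟨-, h1⟩, h2⟩
        exact h1 (hwx ▸ h2)
    have hwS := Finset.disjoint_left.1 hWS hw
    have hc := Finset.card_insert_of_notMem hwS
    have hle := card_filter_subset_le_mul h.1 h.2.1 hrn (S := insert w (T.erase x)) fun hcv => by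
      have := huniq _ (by omega) hcv
      have hx' : x ∈ insert w (T.erase x) := by rwa [this]
      rcases Finset.mem_insert.1 hx' with h | h
      · exact hwx h.symm
      · exact Finset.notMem_erase x T h
    rw [hc, hSc] at hle
    refine le_trans (Finset.card_le_card ?_) hle
    intro F hF
    obtain ⟨hF, ⟨-, hxF⟩, hwF⟩ := Finset.mem_filter.1 hF
    exact Finset.mem_filter.2 ⟨hF, Finset.insert_subset hwF (hsub F hF hxF)⟩

open Classical in
/-- A refined union bound: the sets counted more than once include those that contain `X`, a fixed
element `z₁` of `Z` and a further element of `Z`, and those that contain `X` and two further fixed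
elements of `Z`, but not `z₁`. -/
lemma card_filter_meets_add_le (hrn : r ≤ n) {Z : Finset (Fin n × Fin k)} (hXZ : Disjoint X Z)
    (hs : IsSigned (X ∪ Z)) (hZ : 3 ≤ Z.card) :
    ((signedSupersets r X).filter fun F => ¬ Disjoint F Z).card +
        Z.card * extCount n r k (X.card + 2) ≤
      Z.card * extCount n r k (X.card + 1) + extCount n r k (X.card + 3) := by
  obtain ⟨z₁, h₁, z₂, h₂, z₃, h₃, h12, h13, h23⟩ := Finset.two_lt_card.1 (show 2 < Z.card by omega)
  have hnX : ∀ z ∈ Z, z ∉ X := fun z hz => Finset.disjoint_right.1 hXZ hz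
  have hsub : ∀ z ∈ Z, ∀ S, S ⊆ X ∪ Z → insert z S ⊆ X ∪ Z := fun z hz S hS =>
    Finset.insert_subset (Finset.mem_union_right _ hz) hS
  have hX : X ⊆ X ∪ Z := Finset.subset_union_left
  have e1 := sum_card_signedSupersets_insert (r := r) hrn hXZ hs
  -- Pairs consisting of `z₁` and another element of `Z`.
  have e2 : ∑ F ∈ signedSupersets r (insert z₁ X), (F ∩ Z.erase z₁).card =
      (Z.card - 1) * extCount n r k (X.card + 2) := by
    rw [sum_card_signedSupersets_insert hrn, Finset.card_erase_of_mem h₁,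
      Finset.card_insert_of_notMem (hnX z₁ h₁)]
    · rw [Finset.disjoint_insert_left]
      exact ⟨Finset.notMem_erase _ _, Finset.disjoint_of_subset_right (Finset.erase_subset _ _) hXZ⟩
    · exact hs.mono (Finset.union_subset (hsub z₁ h₁ X hX)
        ((Finset.erase_subset _ _).trans Finset.subset_union_right))
  have c2 : (insert z₂ (insert z₃ X)).card = X.card + 2 := by
    rw [Finset.card_insert_of_notMem, Finset.card_insert_of_notMem (hnX z₃ h₃)]
    simp [h23, hnX z₂ h₂]
  have e3 : (signedSupersets r (insert z₂ (insert z₃ X))).card =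
      extCount n r k (X.card + 2) := by
    rw [(hs.mono (hsub z₂ h₂ _ (hsub z₃ h₃ X hX))).card_signedSupersets hrn, c2]
  have e4 : (signedSupersets r (insert z₁ (insert z₂ (insert z₃ X)))).card =
      extCount n r k (X.card + 3) := by
    rw [(hs.mono (hsub z₁ h₁ _ (hsub z₂ h₂ _ (hsub z₃ h₃ X hX)))).card_signedSupersets hrn,
      Finset.card_insert_of_notMem, c2]
    simp [h12, h13, hnX z₁ h₁]
  have e5 : Z.card * extCount n r k (X.card + 2) =
      (Z.card - 1) * extCount n r k (X.card + 2) + extCount n r k (X.card + 2) := by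
    obtain ⟨a, ha⟩ : ∃ a, Z.card = a + 1 := ⟨Z.card - 1, by omega⟩
    rw [ha, Nat.add_sub_cancel]
    ring
  rw [e5, ← e1]
  nth_rewrite 2 [← e3]
  rw [← e2, ← e4, ← filter_mem_signedSupersets z₁, ← filter_mem_signedSupersets z₂,
    ← filter_mem_signedSupersets z₃, ← filter_mem_signedSupersets z₁,
    ← filter_mem_signedSupersets z₂, ← filter_mem_signedSupersets z₃,
    Finset.filter_filter, Finset.filter_filter, Finset.sum_filter]
  simp only [Finset.card_filter]
  rw [← Finset.sum_add_distrib, ← Finset.sum_add_distrib, ← Finset.sum_add_distrib]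
  refine Finset.sum_le_sum fun F _ => ?_
  have hpos : ¬ Disjoint F Z → 0 < (F ∩ Z).card := fun hd => by
    rwa [Finset.card_pos, ← Finset.not_disjoint_iff_nonempty_inter]
  by_cases hz₁ : z₁ ∈ F
  · have hmem : z₁ ∈ F ∩ Z := Finset.mem_inter.2 ⟨hz₁, h₁⟩
    have hc : (F ∩ Z.erase z₁).card + 1 = (F ∩ Z).card := by
      rw [Finset.inter_erase, Finset.card_erase_add_one hmem]
    simp only [hz₁, and_true, if_true]
    split_ifs <;> omega
  · have htwo : z₃ ∈ F ∧ z₂ ∈ F → 1 < (F ∩ Z).card := fun hF => Finset.one_lt_card.2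
      ⟨z₂, Finset.mem_inter.2 ⟨hF.2, h₂⟩, z₃, Finset.mem_inter.2 ⟨hF.1, h₃⟩, h23⟩
    simp only [hz₁, and_false, if_false]
    by_cases hd : Disjoint F Z <;> by_cases h2 : z₃ ∈ F ∧ z₂ ∈ F <;>
      simp only [hd, h2, and_self, not_true_eq_false, not_false_eq_true, if_true, if_false]
    · have := htwo h2
      omega
    · omega
    · have := htwo h2
      omega
    · have := hpos hd
      omega

/-- The refined bound for the largest possible number of petals, where no member containing `X` misses
all petals. -/
lemma card_add_le_of_max_petals (h𝓕 : 𝓕 ⊆ signedSets n r k) (ht : IsTIntersecting t 𝓕)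
    (hrn : r ≤ n) (hX : X.card = t) (hXs : IsSigned X) {h : ℕ}
    (hZ : (coverPetals t 𝓕 X).card = h) (hh : 3 ≤ h) (hmax : t + h = min (r + 1) n)
    {F₀ : Finset (Fin n × Fin k)} (hF₀ : F₀ ∈ 𝓕) (hXF₀ : ¬ X ⊆ F₀)
    (hN : extCount n r k (t + h - 1) ≤ extCount n r k (t + 3)) :
    𝓕.card + h * extCount n r k (t + 2) ≤
      h * extCount n r k (t + 1) + (t + 1) * extCount n r k (t + 3) := by
  classical
  have hZne : (coverPetals t 𝓕 X).Nonempty := Finset.card_pos.1 (by omega)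
  obtain ⟨W, -, hs, -⟩ := exists_compatible_set h𝓕 hX hXs hZne hF₀ hXF₀
  have h1 := card_filter_meets_add_le (r := r) hrn disjoint_coverPetals hs (by omega)
  have h2 := card_filter_disjoint_petals_le h𝓕 ht hrn hX hXs hZne hF₀ hXF₀
  have h3 : (𝓕.filter fun F => ¬ X ⊆ F).card ≤ t * extCount n r k (t + 3) := by
    refine card_filter_not_subset_le hX hZne fun x hx => ?_
    have hc := card_erase_union_coverPetals (𝓕 := 𝓕) hX hx
    refine (card_filter_subset_le h𝓕 hrn _).trans (le_trans (le_of_eq ?_) hN)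
    congr 1
    omega
  have h4 : (𝓕.filter fun F => X ⊆ F ∧ ¬ Disjoint F (coverPetals t 𝓕 X)).card ≤
      ((signedSupersets r X).filter fun F => ¬ Disjoint F (coverPetals t 𝓕 X)).card := by
    refine Finset.card_le_card fun F hF => ?_
    obtain ⟨hF, hXF, hd⟩ := Finset.mem_filter.1 hF
    exact Finset.mem_filter.2 ⟨mem_signedSupersets.2 ⟨h𝓕 hF, hXF⟩, hd⟩
  have h0 : min (r + 1) n - t - (coverPetals t 𝓕 X).card = 0 := by omega
  rw [h0, zero_mul] at h2
  rw [hZ, hX] at h1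
  rw [card_eq_sum_filter_petals (t := t) X, add_mul, one_mul]
  omega

end Structure

/-! ### The numerical comparisons -/

section Arithmetic

lemma false_of_mul_le {a b q K N₁ N₂ : ℕ} (hN₁ : 0 < N₁) (h : a * N₁ ≤ b * N₂)
    (hK : K * N₂ ≤ q * N₁) (hlt : q * b < a * K) : False := by
  have h1 : a * K * N₂ ≤ q * b * N₂ :=
    calc a * K * N₂ = a * (K * N₂) := by ring
      _ ≤ a * (q * N₁) := Nat.mul_le_mul_left _ hK
      _ = q * (a * N₁) := by ring
      _ ≤ q * (b * N₂) := Nat.mul_le_mul_left _ h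
      _ = q * b * N₂ := by ring
  have h2 : N₂ = 0 := by
    by_contra h0
    exact absurd (Nat.le_of_mul_le_mul_right h1 (Nat.pos_of_ne_zero h0)) (Nat.not_le.2 hlt)
  rw [h2, mul_zero] at h
  have ha : 0 < a := Nat.pos_of_ne_zero fun h0 => by simp [h0] at hlt
  exact absurd h (Nat.not_le.2 (Nat.mul_pos ha hN₁))

lemma add_four_le_of_two_mul_eq {t c : ℕ} (ht : 2 ≤ t) (hc : 2 * c = (t + 1) * (t + 2)) :
    t + 4 ≤ c := by nlinarith

lemma small_no_cover {t c d : ℕ} (ht : 2 ≤ t) (hc : 2 * c = (t + 1) * (t + 2)) (hd : 2 ≤ d)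
    (hdt : d ≤ t + 3) : c * d ^ 2 + (t + 1) < (t + 2) * ((d + 2) * c) := by
  have h := add_four_le_of_two_mul_eq ht hc
  have h1 : d ^ 2 + 1 ≤ (t + 2) * (d + 2) := by
    obtain ⟨a, rfl⟩ : ∃ a, d = a + 1 := ⟨d - 1, by omega⟩
    have : a * (a + 3) ≤ (t + 2) * (a + 3) := Nat.mul_le_mul_right _ (by omega)
    rcases Nat.lt_or_ge a 2 with h2 | h2
    · nlinarith
    · nlinarith
  nlinarith [Nat.mul_le_mul_right c h1]

lemma small_unique_cover {t c d : ℕ} (ht : 2 ≤ t) (hc : 2 * c = (t + 1) * (t + 2))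
    (hdt : d ≤ t + 3) : (t + 1) * d ^ 2 + (t + 1) < (t + 1) * ((d + 2) * c) := by
  have h := add_four_le_of_two_mul_eq ht hc
  have h1 : d ^ 2 + 1 < (d + 2) * c := by
    have : (d + 2) * (d + 1) ≤ (d + 2) * c := Nat.mul_le_mul_left _ (by omega)
    nlinarith
  have := Nat.mul_lt_mul_of_pos_left h1 (show 0 < t + 1 by omega)
  linarith

lemma small_two_petals {t c d v : ℕ} (ht : 2 ≤ t) (hc : 2 * c = (t + 1) * (t + 2))
    (hv : v ≤ t) : v * d + t * d + (t + 1) < t * ((d + 2) * c) := by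
  have h := add_four_le_of_two_mul_eq ht hc
  have h1 : v * d ≤ t * d := Nat.mul_le_mul_right _ hv
  have h2 : t * ((d + 2) * 6) ≤ t * ((d + 2) * c) :=
    Nat.mul_le_mul_left _ (Nat.mul_le_mul_left _ (by omega))
  nlinarith

lemma small_many_petals {t c d u v : ℕ} (ht : 2 ≤ t) (hc : 2 * c = (t + 1) * (t + 2))
    (hu : 1 ≤ u) (hv : v ≤ u) : v * d + t + (t + 1) < u * ((d + 2) * c) := by
  have h := add_four_le_of_two_mul_eq ht hc
  have h1 : v * d ≤ u * d := Nat.mul_le_mul_right _ hv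
  have h2 : u * d ≤ u * d * c := Nat.le_mul_of_pos_right _ (by omega)
  have h3 : c ≤ u * c := Nat.le_mul_of_pos_left _ hu
  nlinarith

variable {t d e m : ℕ}

lemma large_three_covers {u : ℕ} (hed : e ≤ d) (he : 1 ≤ e) (hmd : d ≤ m) (hu : 1 ≤ u) :
    e * (e - 1) < u * ((d + 2) * m) := by
  have h1 : e * (e - 1) ≤ d * m := Nat.mul_le_mul hed (by omega)
  have h2 : (d + 2) * m ≤ u * ((d + 2) * m) := Nat.le_mul_of_pos_left _ hu
  nlinarith

lemma large_no_cover {c : ℕ} (hed : e ≤ d) (hde : d ≤ e + 1) (he : 5 ≤ e) (hmd : d ≤ m)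
    (hmc : 2 * c ≤ m) : 2 * c * d ^ 2 + e * (e - 1) < e * ((d + 2) * m) := by
  have h1 : 2 * c * d ^ 2 ≤ m * d ^ 2 := Nat.mul_le_mul_right _ hmc
  obtain ⟨a, rfl⟩ : ∃ a, e = a + 2 := ⟨e - 2, by omega⟩
  have e1 : a + 2 - 1 = a + 1 := by omega
  rw [e1]
  obtain rfl | rfl : d = a + 2 ∨ d = a + 3 := by omega
  · have h2 := Nat.mul_le_mul_left (a + 2) hmd
    nlinarith
  · have h2 := Nat.mul_le_mul_left (a + 1) hmd
    nlinarith

lemma large_unique_cover (ht : 2 ≤ t) (hed : e ≤ d) (hde : d ≤ e + 1) (he : 5 ≤ e)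
    (hmd : d ≤ m) (hmt : (t + 1) * (t + 2) ≤ m) :
    2 * ((t + 1) * d ^ 2) + e * (e - 1) < (e - 1) * ((d + 2) * m) := by
  have h0 : 4 * (t + 1) ≤ m := by nlinarith
  have h1 : 4 * ((t + 1) * d ^ 2) ≤ m * d ^ 2 := by
    rw [← mul_assoc]
    exact Nat.mul_le_mul_right _ h0
  obtain ⟨a, rfl⟩ : ∃ a, e = a + 5 := ⟨e - 5, by omega⟩
  have e1 : a + 5 - 1 = a + 4 := by omega
  rw [e1]
  obtain rfl | rfl : d = a + 5 ∨ d = a + 6 := by omega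
  · have h2 := Nat.mul_le_mul_left (a + 5) hmd
    nlinarith [Nat.mul_le_mul_left (a ^ 2) hmd]
  · have h2 := Nat.mul_le_mul_left (a + 6) hmd
    nlinarith [Nat.mul_le_mul_left (a ^ 2) hmd, Nat.zero_le (a * m), Nat.zero_le (a ^ 2 * m)]

lemma large_two_petals (ht : 2 ≤ t) (hed : e ≤ d) (hte : t + 3 ≤ e) (hmd : d ≤ m)
    (hmt : (t + 1) * (t + 2) ≤ m) :
    2 * ((e - 2) * d + t * d) + e * (e - 1) < (e - 2) * ((d + 2) * m) := by
  have h0 : 12 ≤ m := by nlinarith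
  obtain ⟨a, rfl⟩ : ∃ a, e = a + 5 := ⟨e - 5, by omega⟩
  have e1 : a + 5 - 1 = a + 4 := by omega
  have e2 : a + 5 - 2 = a + 3 := by omega
  rw [e1, e2]
  have h1 : t * d ≤ (a + 3) * d := Nat.mul_le_mul_right _ (by omega)
  have h2 : (a + 3) * ((d + 2) * 12) ≤ (a + 3) * ((d + 2) * m) :=
    Nat.mul_le_mul_left _ (Nat.mul_le_mul_left _ h0)
  have h3 : (a + 3) * ((a + 7) * (a + 5)) ≤ (a + 3) * ((d + 2) * m) :=
    Nat.mul_le_mul_left _ (Nat.mul_le_mul (by omega) (by omega))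
  nlinarith

lemma large_many_petals {u : ℕ} (ht : 2 ≤ t) (hed : e ≤ d) (hte : t + 3 ≤ e) (hmd : d ≤ m)
    (hmt : (t + 1) * (t + 2) ≤ m) (hu : 1 ≤ u) :
    2 * (u * d + t) + e * (e - 1) < u * ((d + 2) * m) := by
  have h0 : 4 * (t + 1) ≤ m := by nlinarith
  have h1 : e * (e - 1) ≤ d * (d - 1) := Nat.mul_le_mul hed (by omega)
  have h2 : d * (d - 1) + d = d * d := by
    obtain ⟨a, rfl⟩ : ∃ a, d = a + 1 := ⟨d - 1, by omega⟩
    rw [Nat.add_sub_cancel]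
    ring
  have h3 : 2 * d + 2 * t + e * (e - 1) < (d + 2) * m := by
    rcases Nat.lt_or_ge d m with h | h
    · nlinarith
    · nlinarith
  obtain ⟨b, rfl⟩ : ∃ b, u = b + 1 := ⟨u - 1, by omega⟩
  have h4 : b * (2 * d) ≤ b * ((d + 2) * m) := Nat.mul_le_mul_left _ (by nlinarith)
  nlinarith

end Arithmetic

/-! ### The largest non-trivial families -/

lemma nat_bounds_of_gBound_le {n r t k : ℕ} (hn : t + 2 ≤ n) (hr : t + 1 ≤ r)
    (hk : gBound n r t ≤ k) :
    (r + 3 - t) * (t + 2).choose 2 * (r - t - 1) ≤ 1 * (k * (n - t - 1)) ∧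
      (r + 3 - t) * (r + 1 - t) * (r - t - 1) ≤ 2 * (k * (n - t - 1)) := by
  obtain ⟨a, rfl⟩ : ∃ a, r = t + 1 + a := ⟨r - t - 1, by omega⟩
  obtain ⟨b, rfl⟩ : ∃ b, n = t + 2 + b := ⟨n - t - 2, by omega⟩
  have e1 : t + 1 + a + 3 - t = a + 4 := by omega
  have e2 : t + 1 + a + 1 - t = a + 2 := by omega
  have e3 : t + 1 + a - t - 1 = a := by omega
  have e4 : t + 2 + b - t - 1 = b + 1 := by omega
  rw [e1, e2, e3, e4]
  have f1 : ((t + 1 + a : ℕ) : ℝ) - t + 3 = a + 4 := by push_cast; ring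
  have f2 : ((t + 1 + a : ℕ) : ℝ) - t - 1 = a := by push_cast; ring
  have f3 : ((t + 2 + b : ℕ) : ℝ) - t - 1 = b + 1 := by push_cast; ring
  have f4 : ((t + 1 + a : ℕ) : ℝ) - t + 1 = a + 2 := by push_cast; ring
  rw [gBound, f1, f2, f3, f4, div_mul_eq_mul_div, div_le_iff₀ (by positivity)] at hk
  have h0 : (0 : ℝ) ≤ (a + 4) * a := by positivity
  have h1 := (mul_le_mul_of_nonneg_left (le_max_left (((t + 2).choose 2 : ℕ) : ℝ)
    (((a : ℝ) + 2) / 2)) h0).trans hk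
  have h2 := (mul_le_mul_of_nonneg_left (le_max_right (((t + 2).choose 2 : ℕ) : ℝ)
    (((a : ℝ) + 2) / 2)) h0).trans hk
  constructor
  · have : (((a + 4) * (t + 2).choose 2 * a : ℕ) : ℝ) ≤ ((1 * (k * (b + 1)) : ℕ) : ℝ) := by
      push_cast
      linarith
    exact_mod_cast this
  · have : (((a + 4) * (a + 2) * a : ℕ) : ℝ) ≤ ((2 * (k * (b + 1)) : ℕ) : ℝ) := by
      push_cast
      linarith
    exact_mod_cast this

section Largest

variable {n r k t : ℕ} {𝓕 : Finset (Finset (Fin n × Fin k))}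

/-- The alternatives for a largest family: three covers of size `t + 1` in a common `(t + 2)`-set,
no such cover, a single one, or at least two that form a sunflower. -/
lemma IsLargestNontrivialTIntersecting.cases (h : IsLargestNontrivialTIntersecting n r k t 𝓕)
    (hk : 2 ≤ k) (htr : t + 1 ≤ r) (hrn : r ≤ n)
    (hN : ∀ s, t + 1 ≤ s →
      (r + 3 - t) * (t + 2).choose 2 * extCount n r k (s + 1) ≤ extCount n r k s) :
    (∃ X Y : Finset (Fin n × Fin k), IsSigned Y ∧ X ⊆ Y ∧ X.card = t ∧ Y.card = t + 2 ∧
      𝓕 ⊆ pairFamily r X Y) ∨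
    (𝓕.card ≤ (t + 2).choose 2 * (r + 1 - t) ^ 2 * extCount n r k (t + 2)) ∨
    (𝓕.card ≤ extCount n r k (t + 1) +
      (t + 1) * ((r + 1 - t) * ((r + 1 - t) * extCount n r k (t + 2)))) ∨
    (∃ X F₀ : Finset (Fin n × Fin k), X.card = t ∧ IsSigned X ∧ F₀ ∈ 𝓕 ∧ ¬ X ⊆ F₀ ∧
      (∀ T, T.card = t + 1 → IsCover t 𝓕 T → X ⊆ T) ∧ 2 ≤ (coverPetals t 𝓕 X).card ∧
      t + (coverPetals t 𝓕 X).card ≤ min (r + 1) n ∧ IsSigned (X ∪ coverPetals t 𝓕 X)) := by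
  classical
  by_cases hne : ∃ T, T.card = t + 1 ∧ IsCover t 𝓕 T
  swap
  · push Not at hne
    exact Or.inr (Or.inl (card_le_of_no_small_cover h.1 hk (by omega) hrn hN hne))
  rcases exists_common_subset_or_three (𝓣 := {T | T.card = t + 1 ∧ IsCover t 𝓕 T}) (t := t) hne
    (fun T hT => hT.1) (fun T hT T' hT' => h.le_card_inter_of_isCover hk (by omega) hrn hT.2 hT'.2
      (hT.1.trans_le htr) (hT'.1.trans_le htr)) with
    ⟨X, hX, hXT⟩ | ⟨T₁, h₁, T₂, h₂, T₃, h₃, hY, h₃Y, h123⟩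
  swap
  · exact Or.inl (exists_subset_pairFamily_of_three h.1.1 h₁.2 h₂.2 h₃.2 h₁.1 h₂.1 h₃.1 hY h₃Y h123)
  obtain ⟨T, hTc, hT⟩ := hne
  have hcov : ∀ T, T.card = t + 1 → IsCover t 𝓕 T → X ⊆ T := fun T h1 h2 => hXT T ⟨h1, h2⟩
  have hXs : IsSigned X := hT.1.mono (hcov T hTc hT)
  -- A cover of size `t + 1` arises from `X` by adding one petal.
  have hpetal : ∀ T, T.card = t + 1 → IsCover t 𝓕 T → ∃ z ∈ coverPetals t 𝓕 X, T = insert z X := by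
    intro T hTc hT
    have hsub := hcov T hTc hT
    have hsd : (T \ X).card = 1 := by
      rw [Finset.card_sdiff_of_subset hsub]
      omega
    obtain ⟨z, hz⟩ := Finset.card_eq_one.1 hsd
    have hzT : z ∈ T \ X := hz ▸ Finset.mem_singleton_self z
    have e : T = insert z X := by
      rw [← Finset.sdiff_union_of_subset hsub, hz, Finset.singleton_union]
    exact ⟨z, mem_coverPetals.2 ⟨(Finset.mem_sdiff.1 hzT).2, e ▸ hT⟩, e⟩
  obtain ⟨z, hz, hTz⟩ := hpetal T hTc hT
  rcases Nat.lt_or_ge (coverPetals t 𝓕 X).card 2 with hlt | hge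
  · refine Or.inr (Or.inr (Or.inl (card_le_of_unique_cover h.1 hrn hT hTc ?_)))
    intro T' hT'c hT'
    obtain ⟨z', hz', hTz'⟩ := hpetal T' hT'c hT'
    rw [hTz, hTz', Finset.card_le_one.1 (Nat.le_of_lt_succ hlt) z' hz' z hz]
  · obtain ⟨F₀, hF₀, hXF₀⟩ : ∃ F ∈ 𝓕, ¬ X ⊆ F := by
      by_contra! hall
      exact h.1.2.2 ⟨X, mem_signedSets.2 ⟨hX, hXs⟩, hall⟩
    obtain ⟨W, hW, hs, -⟩ := exists_compatible_set h.1.1 hX hXs ⟨z, hz⟩ hF₀ hXF₀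
    exact Or.inr (Or.inr (Or.inr ⟨X, F₀, hX, hXs, hF₀, hXF₀, hcov, hge, by omega, hs⟩))

lemma IsLargestNontrivialTIntersecting.card_pairFamily_le
    (h : IsLargestNontrivialTIntersecting n r k t 𝓕) (hk : 2 ≤ k) (ht : 1 ≤ t) (hrn : r ≤ n)
    {l : ℕ} (hl : t + 2 ≤ l) (hlm : l ≤ min (r + 1) n) :
    (pairFamily r (initialM n k t) (initialM n k l)).card ≤ 𝓕.card := by
  have hcX : (initialM n k t).card = t := card_initialM (by omega) (by omega)
  have hcY : (initialM n k l).card = l := card_initialM (by omega) (by omega)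
  have := pairFamily_isNontrivialTIntersecting (r := r) hk hrn (isSigned_initialM n k l)
    (initialM_mono (show t ≤ l by omega)) (by omega) (by omega) (by omega)
  rw [hcX] at this
  exact h.2 _ this

lemma IsLargestNontrivialTIntersecting.familyIso_of_subset
    (h : IsLargestNontrivialTIntersecting n r k t 𝓕) (hk : 2 ≤ k) (ht : 1 ≤ t) (hrn : r ≤ n)
    {X Y : Finset (Fin n × Fin k)} (hY : IsSigned Y) (hXY : X ⊆ Y) (hX : X.card = t)
    (hYc : t + 2 ≤ Y.card) (hYr : Y.card ≤ r + 1) (hsub : 𝓕 ⊆ pairFamily r X Y) :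
    FamilyIso 𝓕 (familyH1 n r k Y.card t) := by
  subst hX
  rw [h.eq_of_subset
    (pairFamily_isNontrivialTIntersecting hk hrn hY hXY (by omega) (by omega) hYr) hsub]
  exact familyIso_pairFamily (by omega) hY hXY

lemma card_pairFamily_le {X Y : Finset (Fin n × Fin k)} (hrn : r ≤ n) (hX : X.card = t)
    (hY : Y.card = t + 2) : (pairFamily r X Y).card ≤ (t + 2) * extCount n r k (t + 1) := by
  classical
  rw [← hY]
  refine card_le_mul_of_cover Y (fun y F => Y.erase y ⊆ F) ?_ ?_
  · intro F hF
    have hlow : t + 1 ≤ (F ∩ Y).card := by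
      rcases (mem_pairFamily.1 hF).2 with ⟨-, h2⟩ | ⟨-, h2⟩ <;> omega
    have hsd : (Y \ F).card ≤ 1 := by
      have := Finset.card_sdiff_add_card_inter Y F
      rw [Finset.inter_comm] at this
      omega
    obtain ⟨y, hy, hyF⟩ : ∃ y ∈ Y, Y \ F ⊆ {y} := by
      rcases (Y \ F).eq_empty_or_nonempty with h0 | ⟨y, hy⟩
      · obtain ⟨y, hy⟩ := Finset.card_pos.1 (show 0 < Y.card by omega)
        exact ⟨y, hy, by simp [h0]⟩
      · exact ⟨y, (Finset.mem_sdiff.1 hy).1, fun a ha =>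
          Finset.mem_singleton.2 (Finset.card_le_one.1 hsd a ha y hy)⟩
    refine ⟨y, hy, fun a ha => ?_⟩
    obtain ⟨hay, haY⟩ := Finset.mem_erase.1 ha
    by_contra haF
    exact hay (Finset.mem_singleton.1 (hyF (Finset.mem_sdiff.2 ⟨haY, haF⟩)))
  · intro y hy
    have := card_filter_subset_le (𝓕 := pairFamily r X Y) (Finset.filter_subset _ _) hrn (Y.erase y)
    rwa [Finset.card_erase_of_mem hy, hY] at this

end Largest

theorem theorem2 (n r k t : ℕ)
    (ht : 4 ≤ t + 2) (hn : t + 2 ≤ n) (hr : t + 1 ≤ r) (hrn : r ≤ n)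
    (hk : max 2 (gBound n r t) ≤ (k : ℝ))
    (𝓕 : Finset (Finset (Fin n × Fin k)))
    (h𝓕 : IsLargestNontrivialTIntersecting n r k t 𝓕) :
    (min (r + 1) n ≤ 2 * t + 2 → FamilyIso 𝓕 (familyH1 n r k (t + 2) t)) ∧
    (2 * t + 2 < min (r + 1) n → FamilyIso 𝓕 (familyH1 n r k (min (r + 1) n) t)) := by
  have hk2 : 2 ≤ k := by exact_mod_cast (le_max_left _ _).trans hk
  have ht2 : 2 ≤ t := by omega
  obtain ⟨hb1, hb2⟩ := nat_bounds_of_gBound_le hn hr ((le_max_right _ _).trans hk)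
  have hNc : ∀ s, t + 1 ≤ s →
      (r + 3 - t) * (t + 2).choose 2 * extCount n r k (s + 1) ≤ extCount n r k s := fun s hs => by
    have := mul_extCount_succ_le hrn hb1 hs
    rwa [one_mul] at this
  have hNd := mul_extCount_succ_le hrn hb2 (le_refl (t + 1))
  have hN1 : 0 < extCount n r k (t + 1) := extCount_pos (by omega) hr hrn
  have hc : 2 * (t + 2).choose 2 = (t + 1) * (t + 2) := by
    rw [Nat.choose_two_right, Nat.mul_div_cancel' (Nat.even_mul_pred_self (t + 2)).two_dvd]
    rw [mul_comm]
    rfl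
  have hc4 := add_four_le_of_two_mul_eq ht2 hc
  obtain ⟨e, he⟩ : ∃ e, min (r + 1) n = t + e := ⟨min (r + 1) n - t, by omega⟩
  obtain ⟨d, hd⟩ : ∃ d, r + 1 - t = d := ⟨_, rfl⟩
  have hd2 : r + 3 - t = d + 2 := by omega
  have hed : e ≤ d := by omega
  have hde : d ≤ e + 1 := by omega
  have he2 : 2 ≤ e := by omega
  have hanti : ∀ s, t + 2 ≤ s → ∀ s', s ≤ s' → extCount n r k s' ≤ extCount n r k s := by
    intro s hs s' hss'
    induction s', hss' using Nat.le_induction with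
    | base => exact le_rfl
    | succ s' hs' ih =>
      refine le_trans (le_trans (Nat.le_mul_of_pos_left _ ?_) (hNc s' (by omega))) ih
      exact Nat.mul_pos (by omega) (by omega)
  have hNc1 := hNc (t + 1) le_rfl
  have hcases := h𝓕.cases hk2 hr hrn hNc
  have hle2 := fun X F₀ hX hXs hcov hZ hF₀ hXF₀ =>
    card_le_of_two_petals (X := X) (F₀ := F₀) h𝓕.1.1 h𝓕.1.2.1 hrn hX hXs hcov hZ hF₀ hXF₀
  have hle3 := fun X F₀ h hX hXs hZ hh hF₀ hXF₀ =>
    card_le_of_three_le_petals (X := X) (F₀ := F₀) (h := h) (s := t + 2) h𝓕.1.1 h𝓕.1.2.1 hrn hX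
      hXs hZ hh hF₀ hXF₀ (hanti _ le_rfl _ (by omega))
  rw [he, hd, Nat.add_sub_cancel_left] at hle2 hle3
  rw [hd, he] at hcases
  rw [hd2] at hNc1
  rw [hd2, hd] at hNd
  have hcard : ∀ l, t + 2 ≤ l → l ≤ t + e →
      (initialM n k t).card = t ∧ (initialM n k l).card = l := fun l _ _ =>
    ⟨card_initialM (by omega) (by omega), card_initialM (by omega) (by omega)⟩
  constructor
  · intro hm
    have het : e ≤ t + 2 := by omega
    have hdt : d ≤ t + 3 := by omega
    have hlow : (t + 2) * extCount n r k (t + 1) ≤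
        𝓕.card + (t + 1) * extCount n r k (t + 2) := by
      obtain ⟨hcX, hcY⟩ := hcard (t + 2) le_rfl (by omega)
      have h1 := extCount_le_card_pairFamily_add (r := r) hrn (isSigned_initialM n k (t + 2))
        (initialM_mono (show t ≤ t + 2 by omega)) (by omega)
      rw [hcX] at h1
      have h2 := h𝓕.card_pairFamily_le hk2 (by omega) hrn (l := t + 2) le_rfl (by omega)
      omega
    rcases hcases with ⟨X, Y, hY, hXY, hX, hYc, hsub⟩ | hup | hup |
      ⟨X, F₀, hX, hXs, hF₀, hXF₀, hcov, h2, hmax, hs⟩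
    · have := h𝓕.familyIso_of_subset hk2 (by omega) hrn hY hXY hX hYc.ge (by omega) hsub
      rwa [hYc] at this
    · refine (false_of_mul_le hN1 (a := t + 2) ?_ (hNc1.trans_eq (one_mul _).symm)
        ((one_mul _).trans_lt (small_no_cover ht2 hc (by omega) hdt))).elim
      linarith only [hlow, hup]
    · refine (false_of_mul_le hN1 (a := t + 1) ?_ (hNc1.trans_eq (one_mul _).symm)
        ((one_mul _).trans_lt (small_unique_cover ht2 hc hdt))).elim
      linarith only [hlow, hup]
    · obtain ⟨h, hh⟩ : ∃ h, (coverPetals t 𝓕 X).card = h := ⟨_, rfl⟩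
      rw [hh] at h2 hmax
      rcases h2.eq_or_lt with rfl | h3
      · have hup := hle2 X F₀ hX hXs hcov hh hF₀ hXF₀
        refine (false_of_mul_le hN1 (a := t) ?_ (hNc1.trans_eq (one_mul _).symm)
          ((one_mul _).trans_lt (small_two_petals ht2 hc (show e - 2 ≤ t by omega)))).elim
        linarith only [hlow, hup]
      rcases Nat.lt_or_ge h (t + 2) with hlt | hge
      · have hup := hle3 X F₀ h hX hXs hh h3 hF₀ hXF₀
        obtain ⟨u, hu⟩ : ∃ u, t + 2 = h + u := ⟨t + 2 - h, by omega⟩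
        refine (false_of_mul_le hN1 (a := u) ?_ (hNc1.trans_eq (one_mul _).symm)
          ((one_mul _).trans_lt (small_many_petals ht2 hc (show 1 ≤ u by omega)
            (show e - h ≤ u by omega)))).elim
        have hsplit : (t + 2) * extCount n r k (t + 1) =
            h * extCount n r k (t + 1) + u * extCount n r k (t + 1) := by
          rw [hu, add_mul]
        linarith only [hlow, hup, hsplit]
      · -- Here both extremal families have `(t + 2) * N(t + 1)` as the main term of their size.
        obtain rfl : h = t + 2 := by omega
        have hup := card_add_le_of_max_petals h𝓕.1.1 h𝓕.1.2.1 hrn hX hXs hh (by omega) (by omega)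
          hF₀ hXF₀ (hanti (t + 3) (by omega) _ (by omega))
        have hN2 : 0 < extCount n r k (t + 2) := extCount_pos (by omega) (by omega) hrn
        have hNc2 := hNc (t + 2) (by omega)
        refine (false_of_mul_le hN2 (a := 1) (b := t + 1) ?_ (hNc2.trans_eq (one_mul _).symm)
          ?_).elim
        · linarith only [hlow, hup]
        · rw [hd2, one_mul, one_mul]
          exact Nat.lt_of_lt_of_le (by omega) (Nat.le_mul_of_pos_left _ (by omega))
  · intro hm
    have het : t + 3 ≤ e := by omega
    have hchoose : 2 * e.choose 2 = e * (e - 1) := by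
      rw [Nat.choose_two_right, Nat.mul_div_cancel' (Nat.even_mul_pred_self e).two_dvd]
    have hlow : e * extCount n r k (t + 1) ≤
        𝓕.card + e.choose 2 * extCount n r k (t + 2) := by
      obtain ⟨hcX, hcY⟩ := hcard (t + e) (by omega) le_rfl
      have h1 := extCount_le_card_pairFamily_add_choose (r := r) hrn
        (isSigned_initialM n k (t + e)) (initialM_mono (show t ≤ t + e by omega))
        (e := e) (by omega)
      rw [hcX] at h1
      have h2 := h𝓕.card_pairFamily_le hk2 (by omega) hrn (l := t + e) (by omega) (by omega)
      omega
    -- The two lower bounds on `k` in one: `q` is twice the maximum in the definition of `g`.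
    obtain ⟨q, hdq, hcq, hNq⟩ : ∃ q, d ≤ q ∧ 2 * (t + 2).choose 2 ≤ q ∧
        (d + 2) * q * extCount n r k (t + 2) ≤ 2 * extCount n r k (t + 1) := by
      rcases Nat.le_total d (2 * (t + 2).choose 2) with hle | hle
      · exact ⟨_, hle, le_rfl, by linarith only [hNc1]⟩
      · exact ⟨_, le_rfl, hle, hNd⟩
    have htq : (t + 1) * (t + 2) ≤ q := hc ▸ hcq
    rw [he]
    rcases hcases with ⟨X, Y, hY, hXY, hX, hYc, hsub⟩ | hup | hup |
      ⟨X, F₀, hX, hXs, hF₀, hXF₀, hcov, h2, hmax, hs⟩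
    · have hup := (Finset.card_le_card hsub).trans (card_pairFamily_le hrn hX hYc)
      obtain ⟨u, hu⟩ : ∃ u, e = t + 2 + u := ⟨e - (t + 2), by omega⟩
      refine (false_of_mul_le hN1 (a := u) (b := e.choose 2) ?_ hNq ?_).elim
      · have : e * extCount n r k (t + 1) =
            (t + 2) * extCount n r k (t + 1) + u * extCount n r k (t + 1) := by
          rw [hu, add_mul]
        omega
      · rw [hchoose]
        exact large_three_covers hed (by omega) hdq (by omega)
    · refine (false_of_mul_le hN1 (a := e) (b := (t + 2).choose 2 * d ^ 2 + e.choose 2) ?_ hNq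
        ?_).elim
      · linarith only [hlow, hup]
      · rw [mul_add, hchoose, ← mul_assoc]
        exact large_no_cover hed hde (by omega) hdq hcq
    · refine (false_of_mul_le hN1 (a := e - 1) (b := (t + 1) * d ^ 2 + e.choose 2) ?_ hNq
        ?_).elim
      · have : e * extCount n r k (t + 1) =
            (e - 1) * extCount n r k (t + 1) + extCount n r k (t + 1) := by
          rw [← Nat.succ_mul, Nat.succ_eq_add_one, Nat.sub_add_cancel (by omega)]
        linarith only [hlow, hup, this]
      · rw [mul_add, hchoose]
        exact large_unique_cover ht2 hed hde (by omega) hdq htq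
    · obtain ⟨h, hh⟩ : ∃ h, (coverPetals t 𝓕 X).card = h := ⟨_, rfl⟩
      rw [hh] at h2 hmax
      obtain ⟨u, hu⟩ : ∃ u, e = h + u := ⟨e - h, by omega⟩
      have hsplit : e * extCount n r k (t + 1) =
          h * extCount n r k (t + 1) + u * extCount n r k (t + 1) := by
        rw [hu, add_mul]
      rcases Nat.eq_zero_or_pos u with hu0 | hu1
      · have hYc : (X ∪ coverPetals t 𝓕 X).card = t + e := by
          rw [Finset.card_union_of_disjoint disjoint_coverPetals]
          omega
        have := h𝓕.familyIso_of_subset hk2 (by omega) hrn hs Finset.subset_union_left hX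
          (by omega) (by omega) (subset_pairFamily_of_card_petals h𝓕.1.1 h𝓕.1.2.1 hX hXs
            (Finset.card_pos.1 (by omega)) hF₀ hXF₀ (by omega))
        rwa [hYc] at this
      have hue : e - h = u := by omega
      rcases h2.eq_or_lt with rfl | h3
      · have hup := hle2 X F₀ hX hXs hcov hh hF₀ hXF₀
        refine (false_of_mul_le hN1 (a := e - 2) (b := (e - 2) * d + t * d + e.choose 2) ?_ hNq
          ?_).elim
        · rw [hue] at hup ⊢
          linarith only [hlow, hup, hsplit]
        · rw [mul_add, hchoose]
          exact large_two_petals ht2 hed het hdq htq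
      · have hup := hle3 X F₀ h hX hXs hh h3 hF₀ hXF₀
        refine (false_of_mul_le hN1 (a := u) (b := u * d + t + e.choose 2) ?_ hNq ?_).elim
        · rw [hue] at hup
          linarith only [hlow, hup, hsplit]
        · rw [mul_add, hchoose]
          exact large_many_petals ht2 hed het hdq htq hu1
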